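/- Let $p,q,m$ be positive integers and put $n=p+q$. Let $$\mathcal Q(p,q)=\left\{\begin{pmatrix}0&a\\a^t&0\end{pmatrix} : a\in M(p,q)\right\},$$ where $M(p,q)$ is the space of real $p\times q$ matrices; this is a space of real symmetric $n\times n$ matrices. For real $n\times n$ matrices write $[A,B]=AB-BA$ and $\|B\|^2=\operatorname{tr}(BB^t)$. For $P\in \mathrm O(n)$ and $R=(R_{jk})\in \mathrm O(m)$ put $$(P,R)\cdot(B_1,\dots,B_m)=\Big(\sum_{j=1}^m R_{j1}P^tB_jP,\ \dots,\ \sum_{j=1}^m R_{jm}P^tB_jP\Big).$$ Suppose $B_1,\dots,B_m\in\mathcal Q(p,q)$. Then $$\sum_{r,s=1}^m\|[B_r,B_s]\|^2\le\frac12\Big(\sum_{r=1}^m\|B_r\|^2\Big)^2 .$$ Equality holds if and only if there exist $(P,R)\in \mathrm O(n)\times \mathrm O(m)$ and $\lambda\ge 0$ such that $$(P,R)\cdot(B_1,\dots,B_m)=(\lambda\operatorname{diag}(C_1,0),\ \lambda\operatorname{diag}(C_2,0),\ 0,\dots,0),$$ where $$C_1=\begin{pmatrix}0&0&1&0\\0&0&0&1\\1&0&0&0\\0&1&0&0\end{pmatrix},\qquad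 C_2=\begin{pmatrix}0&0&0&-1\\0&0&1&0\\0&1&0&0\\-1&0&0&0\end{pmatrix},$$ and $\operatorname{diag}(C_i,0)$ is the $n\times n$ matrix with upper left block $C_i$ and zeros elsewhere. If $n<4$ or $m<2$, where the right-hand side is not defined as written, only $\lambda=0$ is allowed and the right-hand side means the zero tuple. -/

import Mathlib

open Matrix

/-- The space `Q(p,q)` of block matrices `[[0, a], [aᵗ, 0]]`, where `a` is a real `p × q` matrix. -/
def austereQ (p q : ℕ) : Set (Matrix (Fin (p + q)) (Fin (p + q)) ℝ) :=
  {B | ∃ a : Matrix (Fin p) (Fin q) ℝ,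
    B = Matrix.reindex finSumFinEquiv finSumFinEquiv (Matrix.fromBlocks 0 a aᵀ 0)}

/-- The squared Frobenius norm `‖B‖² = tr (B Bᵗ)`. -/
def frobSq {n : ℕ} (B : Matrix (Fin n) (Fin n) ℝ) : ℝ :=
  (B * Bᵀ).trace

/-- The commutator `[A, B] = AB - BA`. -/
def matComm {n : ℕ} (A B : Matrix (Fin n) (Fin n) ℝ) : Matrix (Fin n) (Fin n) ℝ :=
  A * B - B * A

/-- The action of `(P, R)` on a tuple: the `k`-th entry of `(P, R) · (B₁, …, Bₘ)` is
`∑ⱼ R j k • Pᵗ Bⱼ P`. It is applied to orthogonal `P` and `R`. -/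
def kAct {n m : ℕ} (P : Matrix (Fin n) (Fin n) ℝ) (R : Matrix (Fin m) (Fin m) ℝ)
    (B : Fin m → Matrix (Fin n) (Fin n) ℝ) : Fin m → Matrix (Fin n) (Fin n) ℝ :=
  fun k => ∑ j, R j k • (Pᵀ * B j * P)

/-- The `4 × 4` matrix `C₁`. -/
def matC1 : Matrix (Fin 4) (Fin 4) ℝ :=
  !![0, 0, 1, 0;
     0, 0, 0, 1;
     1, 0, 0, 0;
     0, 1, 0, 0]

/-- The `4 × 4` matrix `C₂`. -/
def matC2 : Matrix (Fin 4) (Fin 4) ℝ :=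
  !![0, 0, 0, -1;
     0, 0, 1, 0;
     0, 1, 0, 0;
     -1, 0, 0, 0]

/-- The `n × n` matrix `diag(C, 0)`; meaningful for `4 ≤ n`. -/
def diagZero (n : ℕ) (C : Matrix (Fin 4) (Fin 4) ℝ) : Matrix (Fin n) (Fin n) ℝ :=
  Matrix.of fun i j =>
    if h : i.val < 4 ∧ j.val < 4 then C ⟨i.val, h.1⟩ ⟨j.val, h.2⟩ else 0

/-- The `m`-tuple `(diag(C₁,0), diag(C₂,0), 0, …, 0)`; meaningful for `4 ≤ n` and `2 ≤ m`. -/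
def modelTuple (n m : ℕ) : Fin m → Matrix (Fin n) (Fin n) ℝ :=
  fun r =>
    if r.val = 0 then diagZero n matC1
    else if r.val = 1 then diagZero n matC2
    else 0

/-! ### Extremal tuples for an antisymmetric bilinear map -/

section Variational

open scoped RealInnerProductSpace

/-! Write `B r = a r + (a r)ᵀ` with `a r` the upper right corner, padded to an n × n matrix, so that
`a r * a s = 0`. Then ‖B_r‖² = 2‖a_r‖², and ‖[B_r, B_s]‖² is `blockCommSq (a r) (a s)`. The
inequality becomes ∑ `blockCommSq (a r) (a s)` ≤ 2 (∑ ‖a_s‖²)², which holds for every tuple of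
square matrices and is invariant under a ↦ U a Vᵀ.

By compactness the best constant C is attained or is 0. At a maximizer, let e be a unit vector
maximizing ∑ ⟪a_s, x⟫², with maximum μ. Stretching the tuple along e gives the first order condition
∑ ‖[e, a_s]‖² = C ∑ ‖a_s‖² (`sum_norm_sq_eq_of_extremal`). So the quartic problem reduces to the
quadratic bound ∑ ‖[e, a_s]‖² ≤ 2 ∑ ‖a_s‖² for such a top direction e.

By singular values, take e = diag(σ) with ∑ σ_i² = 1. The only terms exceeding 2 ∑ ‖a_s‖² come from
antisymmetric parts at pairs with σ_i + σ_k > 1. Maximality of e bounds each such part by 2μ, and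
the diagonal entries contribute a deficit of at least 2μ. The two balance because the total excess ∑
((σ_i + σ_k)² - 1)₊ over ordered pairs is at most 2 (`sum_pairExcess_le`), a weighted graph
inequality.

In the equality case every slack vanishes. Some pair has positive excess, and its normalized
antisymmetric unit is another top direction, with singular values 1/√2, 1/√2, 0, …
(`IsTopDirection.exists_half_isometry`). Repeating the analysis there confines the tuple to the span
of an identity and a quarter turn in one plane (`exists_plane_form`). The relations `a r * a s = 0`
then make the four relevant columns of U and V orthonormal, which gives the model. -/

theorem linear_coeff_eq_zero_of_nonneg {a b c d : ℝ}
    (h : ∀ t : ℝ, 0 ≤ a * t + b * t ^ 2 + c * t ^ 3 + d * t ^ 4) : a = 0 := by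
  have hd : HasDerivAt (fun t : ℝ => a * t + b * t ^ 2 + c * t ^ 3 + d * t ^ 4) a 0 := by
    have := ((((hasDerivAt_id (0 : ℝ)).const_mul a).add
      (((hasDerivAt_id (0 : ℝ)).pow 2).const_mul b)).add
      (((hasDerivAt_id (0 : ℝ)).pow 3).const_mul c)).add
      (((hasDerivAt_id (0 : ℝ)).pow 4).const_mul d)
    exact HasDerivAt.congr_deriv this (by simp)
  refine IsLocalMin.hasDerivAt_eq_zero ?_ hd
  exact Filter.Eventually.of_forall fun t => by simpa using h t

variable {E F : Type*} [NormedAddCommGroup E] [InnerProductSpace ℝ E]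
  [NormedAddCommGroup F] [InnerProductSpace ℝ F] {m : ℕ}

/-- A maximizer of the quadratic form `x ↦ ∑ₛ ⟪aₛ, x⟫²` on the unit sphere is an eigenvector. -/
theorem sum_inner_smul_eq_of_top (a : Fin m → E) {e : E} {μ : ℝ} (he : ‖e‖ = 1) (hμ : 0 ≤ μ)
    (hle : ∀ x, ∑ s, ⟪a s, x⟫ ^ 2 ≤ μ * ‖x‖ ^ 2) (heq : ∑ s, ⟪a s, e⟫ ^ 2 = μ) :
    ∑ s, ⟪a s, e⟫ • a s = μ • e := by
  set w := ∑ s, ⟪a s, e⟫ • a s with hw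
  have hin : ∀ x, ⟪w, x⟫ = ∑ s, ⟪a s, e⟫ * ⟪a s, x⟫ := fun x => by
    simp [hw, sum_inner, real_inner_smul_left]
  have h1 : ⟪w, e⟫ = μ := by rw [hin, ← heq]; exact Finset.sum_congr rfl fun _ _ => by ring
  have h2 : (‖w‖ ^ 2) ^ 2 ≤ μ * (μ * ‖w‖ ^ 2) := by
    calc (‖w‖ ^ 2) ^ 2 = (∑ s, ⟪a s, e⟫ * ⟪a s, w⟫) ^ 2 := by
          rw [← hin, real_inner_self_eq_norm_sq]
      _ ≤ (∑ s, ⟪a s, e⟫ ^ 2) * ∑ s, ⟪a s, w⟫ ^ 2 := Finset.sum_mul_sq_le_sq_mul_sq _ _ _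
      _ ≤ μ * (μ * ‖w‖ ^ 2) := by rw [heq]; exact mul_le_mul_of_nonneg_left (hle w) hμ
  have h3 : ‖w‖ ^ 2 ≤ μ ^ 2 := by
    rcases (sq_nonneg ‖w‖).eq_or_lt with h | h
    · rw [← h]; positivity
    · nlinarith
  have h4 : ‖w - μ • e‖ ^ 2 ≤ 0 := by
    rw [norm_sub_sq_real, real_inner_smul_right, h1, norm_smul, he, mul_one, Real.norm_eq_abs,
      sq_abs]
    nlinarith
  have h5 : ‖w - μ • e‖ = 0 := by
    have := sq_nonneg ‖w - μ • e‖
    exact pow_eq_zero_iff (two_ne_zero) |>.1 (le_antisymm h4 this)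
  exact sub_eq_zero.1 (norm_eq_zero.1 h5)

/-- First order condition at a maximizer, in the direction `aₛ ↦ aₛ + t ⟪aₛ, e⟫ e`. -/
theorem sum_norm_sq_eq_of_extremal (L : E →ₗ[ℝ] E →ₗ[ℝ] F) (hL : ∀ x y, L y x = -L x y)
    (a : Fin m → E) {C : ℝ}
    (hC : ∀ b : Fin m → E, ∑ r, ∑ s, ‖L (b r) (b s)‖ ^ 2 ≤ C * (∑ s, ‖b s‖ ^ 2) ^ 2)
    (ha : ∑ r, ∑ s, ‖L (a r) (a s)‖ ^ 2 = C * (∑ s, ‖a s‖ ^ 2) ^ 2)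
    {e : E} {μ : ℝ} (he : ‖e‖ = 1) (hμ : 0 < μ)
    (hle : ∀ x, ∑ s, ⟪a s, x⟫ ^ 2 ≤ μ * ‖x‖ ^ 2) (heq : ∑ s, ⟪a s, e⟫ ^ 2 = μ) :
    ∑ s, ‖L e (a s)‖ ^ 2 = C * ∑ s, ‖a s‖ ^ 2 := by
  have hM := sum_inner_smul_eq_of_top a he hμ.le hle heq
  set X := ∑ s, ‖a s‖ ^ 2 with hX
  set Φ := ∑ s, ‖L e (a s)‖ ^ 2 with hΦ
  have hee : L e e = 0 := by
    have h := hL e e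
    have h2 : (2 : ℝ) • L e e = 0 := by
      rw [two_smul]; nth_rewrite 1 [h]; simp
    exact (smul_eq_zero.1 h2).resolve_left two_ne_zero
  let v : Fin m → Fin m → F := fun r s => ⟪a r, e⟫ • L e (a s) + ⟪a s, e⟫ • L (a r) e
  have hb : ∀ (t : ℝ) r s, L (a r + (t * ⟪a r, e⟫) • e) (a s + (t * ⟪a s, e⟫) • e) =
      L (a r) (a s) + t • v r s := fun t r s => by
    simp only [map_add, map_smul, LinearMap.add_apply, LinearMap.smul_apply, hee, v, smul_add,
      smul_smul, smul_zero, add_zero]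
    abel
  have hS1 : ∑ r, ∑ s, ⟪L (a r) (a s), ⟪a r, e⟫ • L e (a s)⟫ = μ * Φ := by
    rw [Finset.sum_comm, hΦ, Finset.mul_sum]
    refine Finset.sum_congr rfl fun s _ => ?_
    have : ∑ r, ⟪L (a r) (a s), ⟪a r, e⟫ • L e (a s)⟫ =
        ⟪L (∑ r, ⟪a r, e⟫ • a r) (a s), L e (a s)⟫ := by
      simp [map_sum, LinearMap.sum_apply, sum_inner, real_inner_smul_left, real_inner_smul_right]
    rw [this, hM, map_smul, LinearMap.smul_apply, real_inner_smul_left,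
      real_inner_self_eq_norm_sq]
  have hS2 : ∑ r, ∑ s, ⟪L (a r) (a s), ⟪a s, e⟫ • L (a r) e⟫ = μ * Φ := by
    rw [Finset.sum_comm, ← hS1]
    refine Finset.sum_congr rfl fun r _ => Finset.sum_congr rfl fun s _ => ?_
    rw [hL (a r) (a s), hL e (a s), smul_neg, inner_neg_neg]
  have hS : ∑ r, ∑ s, ⟪L (a r) (a s), v r s⟫ = 2 * (μ * Φ) := by
    simp only [v, inner_add_right, Finset.sum_add_distrib]
    rw [hS1, hS2]; ring
  have hT : ∀ t : ℝ, ∑ r, ∑ s,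
      ‖L (a r + (t * ⟪a r, e⟫) • e) (a s + (t * ⟪a s, e⟫) • e)‖ ^ 2 =
      C * X ^ 2 + 2 * t * (2 * (μ * Φ)) + t ^ 2 * ∑ r, ∑ s, ‖v r s‖ ^ 2 := fun t => by
    rw [← ha, ← hS]
    simp only [Finset.mul_sum, ← Finset.sum_add_distrib]
    refine Finset.sum_congr rfl fun r _ => Finset.sum_congr rfl fun s _ => ?_
    rw [hb, norm_add_sq_real, real_inner_smul_right, norm_smul, mul_pow, Real.norm_eq_abs, sq_abs]
    ring
  have hXt : ∀ t : ℝ, ∑ s, ‖a s + (t * ⟪a s, e⟫) • e‖ ^ 2 = X + 2 * t * μ + t ^ 2 * μ :=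
    fun t => by
    rw [hX, ← heq]
    simp only [Finset.mul_sum, ← Finset.sum_add_distrib]
    refine Finset.sum_congr rfl fun s _ => ?_
    rw [norm_add_sq_real, real_inner_smul_right, norm_smul, mul_pow, Real.norm_eq_abs, sq_abs, he]
    ring
  -- The gap between the two sides of `hC` along the path is a quartic polynomial in t, nonnegative
  -- for both signs of t and zero at t = 0, so its linear coefficient vanishes.
  have key : 4 * C * X * μ - 4 * μ * Φ = 0 := by
    refine linear_coeff_eq_zero_of_nonneg
      (b := C * (4 * μ ^ 2 + 2 * X * μ) - ∑ r, ∑ s, ‖v r s‖ ^ 2) (c := 4 * C * μ ^ 2)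
      (d := C * μ ^ 2) fun t => ?_
    have h := hC fun s => a s + (t * ⟪a s, e⟫) • e
    simp only [hT, hXt] at h
    nlinarith
  have : μ * (C * X - Φ) = 0 := by linarith
  rcases mul_eq_zero.1 this with h | h
  · exact absurd h hμ.ne'
  · linarith

theorem exists_top_direction [FiniteDimensional ℝ E] (a : Fin m → E) (ha : 0 < ∑ s, ‖a s‖ ^ 2) :
    ∃ (e : E) (μ : ℝ), ‖e‖ = 1 ∧ 0 < μ ∧ (∀ x, ∑ s, ⟪a s, x⟫ ^ 2 ≤ μ * ‖x‖ ^ 2) ∧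
      ∑ s, ⟪a s, e⟫ ^ 2 = μ := by
  obtain ⟨s₀, -, hs₀⟩ : ∃ s ∈ Finset.univ, 0 < ‖a s‖ ^ 2 := by
    by_contra! h
    exact absurd (Finset.sum_nonpos h) (not_le.2 ha)
  have hs : 0 < ‖a s₀‖ := by
    rcases (norm_nonneg (a s₀)).eq_or_lt with h | h
    · rw [← h] at hs₀; norm_num at hs₀
    · exact h
  have hunit : ∀ x : E, 0 < ‖x‖ → ‖(‖x‖⁻¹ : ℝ) • x‖ = 1 := fun x hx => by
    rw [norm_smul, norm_inv, norm_norm, inv_mul_cancel₀ hx.ne']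
  have hne : (Metric.sphere (0 : E) 1).Nonempty :=
    ⟨(‖a s₀‖⁻¹ : ℝ) • a s₀, by simpa using hunit _ hs⟩
  obtain ⟨e, he, hmax⟩ := (isCompact_sphere (0 : E) 1).exists_isMaxOn hne
    (f := fun x => ∑ s, ⟪a s, x⟫ ^ 2) (by fun_prop)
  have hle : ∀ x, ∑ s, ⟪a s, x⟫ ^ 2 ≤ (∑ s, ⟪a s, e⟫ ^ 2) * ‖x‖ ^ 2 := fun x => by
    rcases (norm_nonneg x).eq_or_lt with h | h
    · have : x = 0 := norm_eq_zero.1 h.symm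
      simp [this]
    · have hx := hmax (a := (‖x‖⁻¹ : ℝ) • x) (by simpa using hunit x h)
      simp only [Set.mem_ofPred_eq, real_inner_smul_right, mul_pow, ← Finset.mul_sum] at hx
      rw [inv_pow, inv_mul_le_iff₀ (by positivity)] at hx
      linarith
  refine ⟨e, _, by simpa using he, ?_, hle, rfl⟩
  have h1 := hle (a s₀)
  have h2 : ⟪a s₀, a s₀⟫ ^ 2 ≤ ∑ s, ⟪a s, a s₀⟫ ^ 2 :=
    Finset.single_le_sum (f := fun s => ⟪a s, a s₀⟫ ^ 2) (fun _ _ => sq_nonneg _)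
      (Finset.mem_univ s₀)
  rw [real_inner_self_eq_norm_sq] at h2
  by_contra! h
  have : (∑ s, ⟪a s, e⟫ ^ 2) * ‖a s₀‖ ^ 2 ≤ 0 := mul_nonpos_of_nonpos_of_nonneg h hs₀.le
  nlinarith

theorem exists_quartic_maximum [FiniteDimensional ℝ E] [FiniteDimensional ℝ F]
    (L : E →ₗ[ℝ] E →ₗ[ℝ] F) (m : ℕ) :
    ∃ C : ℝ,
      (∀ b : Fin m → E, ∑ r, ∑ s, ‖L (b r) (b s)‖ ^ 2 ≤ C * (∑ s, ‖b s‖ ^ 2) ^ 2) ∧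
      (C = 0 ∨ ∃ a : Fin m → E, 0 < ∑ s, ‖a s‖ ^ 2 ∧
        ∑ r, ∑ s, ‖L (a r) (a s)‖ ^ 2 = C * (∑ s, ‖a s‖ ^ 2) ^ 2) := by
  have hnorm : ∀ x : PiLp 2 fun _ : Fin m => E, ∑ s, ‖x s‖ ^ 2 = ‖x‖ ^ 2 := fun x => (PiLp.norm_sq_eq_of_L2 _ x).symm
  let T : (PiLp 2 fun _ : Fin m => E) → ℝ := fun x => ∑ r, ∑ s, ‖L (x r) (x s)‖ ^ 2
  have hcont : Continuous T := by
    have h : ∀ x : PiLp 2 fun _ : Fin m => E, T x = ∑ r, ∑ s, ‖L.toContinuousBilinearMap (x r) (x s)‖ ^ 2 :=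
      fun x => rfl
    rw [show T = _ from funext h]
    fun_prop
  have hhom : ∀ (c : ℝ) (x : PiLp 2 fun _ : Fin m => E), T (c • x) = c ^ 4 * T x := fun c x => by
    simp only [T, PiLp.smul_apply, map_smul, LinearMap.smul_apply, norm_smul, mul_pow,
      Real.norm_eq_abs, sq_abs, Finset.mul_sum]
    exact Finset.sum_congr rfl fun r _ => Finset.sum_congr rfl fun s _ => by ring
  -- An empty sphere means that the space of tuples is zero; no nonzero maximizer exists and C = 0
  -- serves.
  rcases (Metric.sphere (0 : PiLp 2 fun _ : Fin m => E) 1).eq_empty_or_nonempty with hempty | hne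
  · have hz : ∀ x : PiLp 2 fun _ : Fin m => E, x = 0 := fun x => by
      by_contra hx
      have : (‖x‖⁻¹ : ℝ) • x ∈ Metric.sphere (0 : PiLp 2 fun _ : Fin m => E) 1 := by
        simp [norm_smul, inv_mul_cancel₀ (norm_ne_zero_iff.2 hx)]
      rw [hempty] at this
      exact this
    refine ⟨0, fun b => ?_, Or.inl rfl⟩
    have hb : ∀ s, b s = 0 := fun s => by
      have := congrArg (fun x : PiLp 2 fun _ : Fin m => E => x s) (hz (WithLp.toLp 2 b))
      simpa using this
    simp [hb]
  · obtain ⟨a, ha, hmax⟩ := (isCompact_sphere (0 : PiLp 2 fun _ : Fin m => E) 1).exists_isMaxOn hne hcont.continuousOn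
    have ha1 : ‖a‖ = 1 := by simpa using ha
    refine ⟨T a, fun b => ?_, Or.inr ⟨a, ?_, ?_⟩⟩
    · let x : PiLp 2 fun _ : Fin m => E := WithLp.toLp 2 b
      change T x ≤ T a * (∑ s, ‖x s‖ ^ 2) ^ 2
      rw [hnorm]
      rcases (norm_nonneg x).eq_or_lt with h | h
      · have hx : x = 0 := norm_eq_zero.1 h.symm
        simp [hx, T]
      · have h1 := hmax (a := (‖x‖⁻¹ : ℝ) • x) (by
          simp [norm_smul, inv_mul_cancel₀ h.ne'])
        simp only [Set.mem_ofPred_eq, hhom] at h1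
        rw [inv_pow, inv_mul_le_iff₀ (by positivity)] at h1
        linarith [show (‖x‖ ^ 2) ^ 2 = ‖x‖ ^ 4 by ring, mul_comm (T a) (‖x‖ ^ 4),
          congrArg (T a * ·) (show (‖x‖ ^ 2) ^ 2 = ‖x‖ ^ 4 by ring)]
    · rw [hnorm, ha1]; norm_num
    · rw [hnorm, ha1]; simp [T]

/-- At a nonzero maximizer the first order condition turns `htop` into C ∑ ‖a_s‖² ≤ K ∑ ‖a_s‖²,
hence C ≤ K. A bound linear in the tuple, needed only at top directions, thus yields the quartic
bound. -/
theorem sum_norm_sq_le_of_top_bound [FiniteDimensional ℝ E] [FiniteDimensional ℝ F]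
    (L : E →ₗ[ℝ] E →ₗ[ℝ] F) (hL : ∀ x y, L y x = -L x y) {K : ℝ} (hK : 0 ≤ K)
    (htop : ∀ (a : Fin m → E) (e : E) (μ : ℝ), ‖e‖ = 1 → 0 < μ →
      (∀ x, ∑ s, ⟪a s, x⟫ ^ 2 ≤ μ * ‖x‖ ^ 2) → ∑ s, ⟪a s, e⟫ ^ 2 = μ →
      ∑ s, ‖L e (a s)‖ ^ 2 ≤ K * ∑ s, ‖a s‖ ^ 2) (b : Fin m → E) :
    ∑ r, ∑ s, ‖L (b r) (b s)‖ ^ 2 ≤ K * (∑ s, ‖b s‖ ^ 2) ^ 2 := by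
  obtain ⟨C, hC, h⟩ := exists_quartic_maximum L m
  refine (hC b).trans (mul_le_mul_of_nonneg_right ?_ (sq_nonneg _))
  rcases h with rfl | ⟨a, ha, haC⟩
  · exact hK
  · obtain ⟨e, μ, he, hμ, hle, heq⟩ := exists_top_direction a ha
    have h1 := sum_norm_sq_eq_of_extremal L hL a hC haC he hμ hle heq
    have h2 := htop a e μ he hμ hle heq
    rw [h1] at h2
    exact le_of_mul_le_mul_right h2 ha

end Variational

/-! ### Orthogonal completion and singular values -/

section OrthogonalMatrices

variable {ι : Type*} [Fintype ι] [DecidableEq ι]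

theorem mem_orthogonalGroup_iff_transpose_mul {U : Matrix ι ι ℝ} :
    U ∈ Matrix.orthogonalGroup ι ℝ ↔ Uᵀ * U = 1 := by
  rw [Matrix.mem_orthogonalGroup_iff']

theorem mul_transpose_of_mem_orthogonalGroup {U : Matrix ι ι ℝ}
    (hU : U ∈ Matrix.orthogonalGroup ι ℝ) : U * Uᵀ = 1 :=
  mul_eq_one_comm.1 (mem_orthogonalGroup_iff_transpose_mul.1 hU)

/-- A partially prescribed orthonormal system of columns extends to an orthogonal matrix. -/
theorem exists_orthogonal_extension (v : ι → ι → ℝ) (s : Set ι)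
    (hv : ∀ i ∈ s, ∀ j ∈ s, v i ⬝ᵥ v j = if i = j then 1 else 0) :
    ∃ U ∈ Matrix.orthogonalGroup ι ℝ, ∀ j ∈ s, ∀ i, U i j = v j i := by
  have horth : Orthonormal ℝ (s.domRestrict fun i => (WithLp.toLp 2 (v i) : EuclideanSpace ℝ ι)) := by
    rw [orthonormal_iff_ite]
    rintro ⟨i, hi⟩ ⟨j, hj⟩
    have := hv j hj i hi
    rw [Set.domRestrict_apply, Set.domRestrict_apply, EuclideanSpace.inner_toLp_toLp, star_trivial,
      this]
    simp only [Subtype.mk.injEq, eq_comm]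
  obtain ⟨b, hb⟩ := horth.exists_orthonormalBasis_extension_of_card_eq (by simp)
  refine ⟨Matrix.of fun i j => b j i, ?_, fun j hj i => by simp [hb j hj]⟩
  rw [mem_orthogonalGroup_iff_transpose_mul]
  ext i j
  have := orthonormal_iff_ite.1 b.orthonormal i j
  rw [PiLp.inner_apply] at this
  simpa [Matrix.mul_apply, Matrix.one_apply, mul_comm] using this

theorem exists_singular_value_decomposition (a : Matrix ι ι ℝ) :
    ∃ U ∈ Matrix.orthogonalGroup ι ℝ, ∃ V ∈ Matrix.orthogonalGroup ι ℝ, ∃ σ : ι → ℝ,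
      (∀ i, 0 ≤ σ i) ∧ a = U * diagonal σ * Vᵀ := by
  have hS : (aᵀ * a).IsHermitian := by
    simpa using Matrix.isHermitian_conjTranspose_mul_self a
  obtain ⟨V, hV, d, hd⟩ : ∃ V ∈ Matrix.orthogonalGroup ι ℝ, ∃ d : ι → ℝ,
      aᵀ * a = V * diagonal d * Vᵀ := by
    refine ⟨hS.eigenvectorUnitary, hS.eigenvectorUnitary.2, hS.eigenvalues, ?_⟩
    have := hS.spectral_theorem
    rw [Unitary.conjStarAlgAut_apply] at this
    simpa [star_eq_conjTranspose] using this
  have hVV := mem_orthogonalGroup_iff_transpose_mul.1 hV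
  have hVV' := mul_transpose_of_mem_orthogonalGroup hV
  have hW : (a * V)ᵀ * (a * V) = diagonal d := by
    rw [transpose_mul, Matrix.mul_assoc, ← Matrix.mul_assoc aᵀ, hd]
    simp only [Matrix.mul_assoc, hVV, Matrix.mul_one]
    rw [← Matrix.mul_assoc, hVV, Matrix.one_mul]
  have hWe : ∀ i j, (a * V)ᵀ i ⬝ᵥ (a * V)ᵀ j = if i = j then d i else 0 := fun i j => by
    have := congrFun (congrFun hW i) j
    rw [diagonal_apply] at this
    rw [← this]; rfl
  have hd0 : ∀ i, 0 ≤ d i := fun i => by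
    have := hWe i i
    rw [if_pos rfl] at this
    rw [← this]
    exact Finset.sum_nonneg fun _ _ => mul_self_nonneg _
  have hsq : ∀ i, √(d i) * √(d i) = d i := fun i => Real.mul_self_sqrt (hd0 i)
  -- The columns of a V are orthogonal with squared lengths d. The nonzero ones are normalized and
  -- completed arbitrarily; the others vanish, so the completion is harmless.
  obtain ⟨U, hU, hUv⟩ := exists_orthogonal_extension (fun i => (√(d i))⁻¹ • (a * V)ᵀ i)
    {i | d i ≠ 0} (by
      intro i hi j hj
      rw [smul_dotProduct, dotProduct_smul, hWe]
      split_ifs with h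
      · subst h
        have : √(d i) ≠ 0 := by rw [Real.sqrt_ne_zero (hd0 i)]; exact hi
        rw [smul_eq_mul, smul_eq_mul, ← mul_assoc, ← mul_inv, hsq, inv_mul_cancel₀ hi]
      · simp)
  refine ⟨U, hU, V, hV, fun i => √(d i), fun i => Real.sqrt_nonneg _, ?_⟩
  have h1 : a * V = U * diagonal fun i => √(d i) := by
    ext i j
    rw [mul_diagonal]
    by_cases hj : d j = 0
    · have h0 := hWe j j
      rw [if_pos rfl, hj, dotProduct_self_eq_zero] at h0
      simpa [hj] using congrFun h0 i
    · have : √(d j) ≠ 0 := by rwa [Real.sqrt_ne_zero (hd0 j)]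
      rw [hUv j hj]
      simp only [Pi.smul_apply, smul_eq_mul, transpose_apply]
      field_simp
  rw [← h1, Matrix.mul_assoc, hVV', Matrix.mul_one]

end OrthogonalMatrices

/-! ### A weighted graph inequality and the excess bound -/

section GramBound

variable {ι : Type*} [Fintype ι]

/-- View c as edge weights with degrees d and total degree D. For an edge {i, k}, d_i + d_k - c_ik
counts every edge meeting {i, k} once, so it is at most the total edge weight D / 2. Averaging this
over edges with weight c gives the claim. -/
theorem four_mul_sum_rowSum_sq_le {c : ι → ι → ℝ} (hsymm : ∀ i k, c i k = c k i)
    (hdiag : ∀ i, c i i = 0) (hc : ∀ i k, 0 ≤ c i k) :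
    4 * ∑ j, (∑ k, c j k) ^ 2 ≤ (∑ i, ∑ k, c i k) ^ 2 + 2 * ∑ i, ∑ k, c i k ^ 2 := by
  classical
  set d : ι → ℝ := fun j => ∑ k, c j k with hd
  set D : ℝ := ∑ j, d j with hD
  have hedge : ∀ i k, i ≠ k → 2 * d i + 2 * d k - 2 * c i k ≤ D := fun i k hik => by
    have hx : ∀ x, c x i + c x k ≤ d x := fun x => by
      rw [hd, ← Finset.sum_pair (f := fun y => c x y) hik]
      exact Finset.sum_le_sum_of_subset_of_nonneg (Finset.subset_univ _) fun _ _ _ => hc _ _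
    have h1 : ∑ x ∈ {i, k}, (d x - c x i - c x k) ≤ ∑ x, (d x - c x i - c x k) :=
      Finset.sum_le_sum_of_subset_of_nonneg (Finset.subset_univ _) fun x _ _ => by
        linarith [hx x]
    rw [Finset.sum_pair hik, Finset.sum_sub_distrib, Finset.sum_sub_distrib] at h1
    have h2 : ∀ y, ∑ x, c x y = d y := fun y => Finset.sum_congr rfl fun x _ => hsymm x y
    rw [h2, h2, hdiag, hdiag, hsymm k i] at h1
    linarith
  have h1 : ∑ i, ∑ k, c i k * (2 * d i + 2 * d k - 2 * c i k) ≤ ∑ i, ∑ k, c i k * D := by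
    refine Finset.sum_le_sum fun i _ => Finset.sum_le_sum fun k _ => ?_
    by_cases hik : i = k
    · subst hik; simp [hdiag]
    · exact mul_le_mul_of_nonneg_left (hedge i k hik) (hc i k)
  have h2 : ∑ i, ∑ k, c i k * D = D ^ 2 := by
    simp only [← Finset.sum_mul]; rw [sq]
  have h3 : ∑ i, ∑ k, c i k * d i = ∑ j, d j ^ 2 :=
    Finset.sum_congr rfl fun i _ => by rw [← Finset.sum_mul, sq]
  have h4 : ∑ i, ∑ k, c i k * d k = ∑ j, d j ^ 2 := by
    rw [Finset.sum_comm, ← h3]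
    exact Finset.sum_congr rfl fun i _ => Finset.sum_congr rfl fun k _ => by rw [hsymm]
  have h5 : ∑ i, ∑ k, c i k * (2 * d i + 2 * d k - 2 * c i k) =
      2 * ∑ i, ∑ k, c i k * d i + 2 * ∑ i, ∑ k, c i k * d k - 2 * ∑ i, ∑ k, c i k ^ 2 := by
    simp only [Finset.mul_sum, ← Finset.sum_add_distrib, ← Finset.sum_sub_distrib]
    exact Finset.sum_congr rfl fun i _ => Finset.sum_congr rfl fun k _ => by ring
  rw [h5, h3, h4, h2] at h1
  linarith

/-- The positive part of `(σᵢ + σₖ)² - 1` off the diagonal. -/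
noncomputable def pairExcess [DecidableEq ι] (σ : ι → ℝ) (i k : ι) : ℝ :=
  if i ≠ k ∧ 1 < (σ i + σ k) ^ 2 then (σ i + σ k) ^ 2 - 1 else 0

/-- Join i and k when σ_i + σ_k > 1, with that sum as weight. Let N be the number of ordered edges,
Q the sum of squared weights, and d the degrees; the excess is Q - N. Since Q = 2 ∑ σ_j d_j and σ is
a unit vector, Q² ≤ 4 ∑ d_j². The graph inequality and Cauchy–Schwarz bound this by NQ + 2Q. -/
theorem sum_pairExcess_le [DecidableEq ι] {σ : ι → ℝ} (hσ : ∀ i, 0 ≤ σ i)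
    (h1 : ∑ i, σ i ^ 2 = 1) : ∑ i, ∑ k, pairExcess σ i k ≤ 2 := by
  set χ : ι → ι → ℝ := fun i k => if i ≠ k ∧ 1 < (σ i + σ k) ^ 2 then 1 else 0 with hχ
  set c : ι → ι → ℝ := fun i k => χ i k * (σ i + σ k) with hcdef
  have hχsymm : ∀ i k, χ i k = χ k i := fun i k => by
    simp only [hχ, ne_comm (a := i), add_comm (σ i)]
  have hχsq : ∀ i k, χ i k ^ 2 = χ i k := fun i k => by simp only [hχ]; split_ifs <;> simp
  have hχ0 : ∀ i k, 0 ≤ χ i k := fun i k => by simp only [hχ]; split_ifs <;> simp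
  have hB := four_mul_sum_rowSum_sq_le (c := c)
    (fun i k => by simp only [hcdef, hχsymm i k, add_comm (σ i)])
    (fun i => by simp [hcdef, hχ])
    (fun i k => mul_nonneg (hχ0 i k) (add_nonneg (hσ i) (hσ k)))
  set Q : ℝ := ∑ i, ∑ k, c i k ^ 2 with hQ
  set N : ℝ := ∑ i, ∑ k, χ i k with hN
  have hex : ∑ i, ∑ k, pairExcess σ i k = Q - N := by
    simp only [hQ, hN, ← Finset.sum_sub_distrib]
    refine Finset.sum_congr rfl fun i _ => Finset.sum_congr rfl fun k _ => ?_
    simp only [pairExcess, hcdef, hχ]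
    split_ifs <;> simp
  have hcs : (∑ i, ∑ k, c i k) ^ 2 ≤ N * Q := by
    have := Finset.sum_mul_sq_le_sq_mul_sq (Finset.univ : Finset (ι × ι))
      (fun e => χ e.1 e.2) (fun e => c e.1 e.2)
    simp only [Fintype.sum_prod_type, hχsq] at this
    have hχc : ∀ i k, χ i k * c i k = c i k := fun i k => by
      rw [hcdef, ← mul_assoc, ← sq, hχsq]
    simpa only [hχc] using this
  have hQd : Q = 2 * ∑ j, σ j * ∑ k, c j k := by
    have e1 : Q = ∑ i, ∑ k, (σ i * c i k + σ k * c i k) :=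
      Finset.sum_congr rfl fun i _ => Finset.sum_congr rfl fun k _ => by
        simp only [hcdef, mul_pow, hχsq]; ring
    have e2 : ∑ i, ∑ k, σ k * c i k = ∑ i, ∑ k, σ i * c i k := by
      rw [Finset.sum_comm]
      exact Finset.sum_congr rfl fun i _ => Finset.sum_congr rfl fun k _ => by
        simp only [hcdef, hχsymm i k, add_comm (σ i)]
    simp only [Finset.sum_add_distrib] at e1
    rw [e1, e2, two_mul]
    simp only [Finset.mul_sum]
  have hQsq : Q ^ 2 ≤ 4 * ∑ j, (∑ k, c j k) ^ 2 := by
    have := Finset.sum_mul_sq_le_sq_mul_sq Finset.univ σ fun j => ∑ k, c j k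
    rw [h1, one_mul] at this
    rw [hQd, mul_pow]; linarith
  have hQ0 : 0 ≤ Q := Finset.sum_nonneg fun _ _ => Finset.sum_nonneg fun _ _ => sq_nonneg _
  have hN0 : 0 ≤ N := Finset.sum_nonneg fun _ _ => Finset.sum_nonneg fun _ _ => hχ0 _ _
  rw [hex]
  rcases hQ0.eq_or_lt with h | h
  · linarith
  · have : Q * Q ≤ (N + 2) * Q := by nlinarith
    linarith [le_of_mul_le_mul_right this h]

end GramBound

/-! ### Commutators with a diagonal direction -/

section MatrixCommutators

variable {ι : Type*} [Fintype ι] {m : ℕ}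

/-- The Frobenius inner product of square matrices. -/
def frobInner (a b : Matrix ι ι ℝ) : ℝ := ∑ i, ∑ k, a i k * b i k

/-- The squared norm of the commutator of the symmetric block matrices with corners `a`, `b`. -/
def blockCommSq (a b : Matrix ι ι ℝ) : ℝ :=
  ∑ i, ∑ k, ((a * bᵀ - b * aᵀ) i k ^ 2 + (aᵀ * b - bᵀ * a) i k ^ 2)

theorem frobInner_eq_trace (a b : Matrix ι ι ℝ) : frobInner a b = (a * bᵀ).trace := by
  simp [frobInner, trace, mul_apply]

theorem frobInner_self_eq (a : Matrix ι ι ℝ) : frobInner a a = ∑ i, ∑ k, a i k ^ 2 :=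
  Finset.sum_congr rfl fun _ _ => Finset.sum_congr rfl fun _ _ => (sq _).symm

theorem frobInner_self_nonneg (a : Matrix ι ι ℝ) : 0 ≤ frobInner a a := by
  rw [frobInner_self_eq]
  exact Finset.sum_nonneg fun _ _ => Finset.sum_nonneg fun _ _ => sq_nonneg _

theorem blockCommSq_eq (a b : Matrix ι ι ℝ) :
    blockCommSq a b = frobInner (a * bᵀ - b * aᵀ) (a * bᵀ - b * aᵀ) +
      frobInner (aᵀ * b - bᵀ * a) (aᵀ * b - bᵀ * a) := by
  simp only [blockCommSq, frobInner_self_eq, Finset.sum_add_distrib]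

variable [DecidableEq ι]

theorem frobInner_conj {U V : Matrix ι ι ℝ} (hU : U ∈ Matrix.orthogonalGroup ι ℝ)
    (hV : V ∈ Matrix.orthogonalGroup ι ℝ) (a b : Matrix ι ι ℝ) :
    frobInner (U * a * Vᵀ) (U * b * Vᵀ) = frobInner a b := by
  have hU' := mem_orthogonalGroup_iff_transpose_mul.1 hU
  have hV' := mem_orthogonalGroup_iff_transpose_mul.1 hV
  rw [frobInner_eq_trace, frobInner_eq_trace]
  have h : U * a * Vᵀ * (U * b * Vᵀ)ᵀ = U * (a * bᵀ * Uᵀ) := by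
    simp only [transpose_mul, transpose_transpose, Matrix.mul_assoc]
    rw [← Matrix.mul_assoc Vᵀ, hV', Matrix.one_mul]
  rw [h, trace_mul_comm, Matrix.mul_assoc, hU', Matrix.mul_one]

theorem blockCommSq_conj {U V : Matrix ι ι ℝ} (hU : U ∈ Matrix.orthogonalGroup ι ℝ)
    (hV : V ∈ Matrix.orthogonalGroup ι ℝ) (a b : Matrix ι ι ℝ) :
    blockCommSq (U * a * Vᵀ) (U * b * Vᵀ) = blockCommSq a b := by
  have h1 : ∀ (U V : Matrix ι ι ℝ), Vᵀ * V = 1 → ∀ a b : Matrix ι ι ℝ,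
      U * a * Vᵀ * (U * b * Vᵀ)ᵀ = U * (a * bᵀ) * Uᵀ := fun U V hV a b => by
    simp only [transpose_mul, transpose_transpose, Matrix.mul_assoc]
    rw [← Matrix.mul_assoc Vᵀ, hV, Matrix.one_mul]
  have h2 : ∀ (U V : Matrix ι ι ℝ), Uᵀ * U = 1 → ∀ a b : Matrix ι ι ℝ,
      (U * a * Vᵀ)ᵀ * (U * b * Vᵀ) = V * (aᵀ * b) * Vᵀ := fun U V hU a b => by
    simp only [transpose_mul, transpose_transpose, Matrix.mul_assoc]
    rw [← Matrix.mul_assoc Uᵀ, hU, Matrix.one_mul]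
  have hU' := mem_orthogonalGroup_iff_transpose_mul.1 hU
  have hV' := mem_orthogonalGroup_iff_transpose_mul.1 hV
  have hs : ∀ W x y : Matrix ι ι ℝ, W * x * Wᵀ - W * y * Wᵀ = W * (x - y) * Wᵀ := fun W x y => by
    rw [Matrix.mul_sub, Matrix.sub_mul]
  rw [blockCommSq_eq, blockCommSq_eq, h1 U V hV', h1 U V hV', h2 U V hU', h2 U V hU', hs, hs,
    frobInner_conj hU hU, frobInner_conj hV hV]

/-- For each pair (i, k) the form is diagonal in b_ik ± b_ki, with factors (σ_i ∓ σ_k)². Subtracting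
1 from each factor isolates the deviation from 2‖b‖². -/
theorem blockCommSq_diagonal (σ : ι → ℝ) (b : Matrix ι ι ℝ) :
    blockCommSq (diagonal σ) b = 2 * frobInner b b +
      1 / 2 * ∑ i, ∑ k, (((σ i + σ k) ^ 2 - 1) * (b i k - b k i) ^ 2 +
        ((σ i - σ k) ^ 2 - 1) * (b i k + b k i) ^ 2) := by
  have h : 2 * frobInner b b = ∑ i, ∑ k, (b i k ^ 2 + b k i ^ 2) := by
    simp only [Finset.sum_add_distrib, frobInner_self_eq]
    rw [Finset.sum_comm (f := fun i k => b k i ^ 2)]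
    ring
  rw [h, blockCommSq]
  simp only [Finset.mul_sum, ← Finset.sum_add_distrib]
  refine Finset.sum_congr rfl fun i _ => Finset.sum_congr rfl fun k _ => ?_
  simp only [Matrix.sub_apply, diagonal_transpose, diagonal_mul, mul_diagonal, transpose_apply]
  ring

theorem frobInner_diagonal_right (a : Matrix ι ι ℝ) (σ : ι → ℝ) :
    frobInner a (diagonal σ) = ∑ i, a i i * σ i := by
  simp [frobInner, diagonal_apply]

theorem frobInner_single_sub_single (a : Matrix ι ι ℝ) (i k : ι) :
    frobInner a (single i k 1 - single k i 1) = a i k - a k i := by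
  simp only [frobInner, Matrix.sub_apply, mul_sub, Finset.sum_sub_distrib]
  simp [single_apply, ite_and, Finset.sum_ite_eq]

/-- The comparison at a maximal direction in diagonal form, with the equality conditions. -/
theorem sum_blockCommSq_diagonal_le {σ : ι → ℝ} (hσ : ∀ i, 0 ≤ σ i) (h1 : ∑ i, σ i ^ 2 = 1)
    (a : Fin m → Matrix ι ι ℝ) {μ : ℝ} (hμ : 0 ≤ μ)
    (hle : ∀ x, ∑ s, frobInner (a s) x ^ 2 ≤ μ * frobInner x x)
    (heq : ∑ s, frobInner (a s) (diagonal σ) ^ 2 = μ) :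
    ∑ s, blockCommSq (diagonal σ) (a s) ≤ 2 * ∑ s, frobInner (a s) (a s) ∧
    (∑ s, blockCommSq (diagonal σ) (a s) = 2 * ∑ s, frobInner (a s) (a s) →
      μ * (2 - ∑ i, ∑ k, pairExcess σ i k) = 0 ∧
      ∑ s, ∑ i, a s i i ^ 2 = μ ∧
      ∀ i k, i ≠ k →
        ((σ i + σ k) ^ 2 - 1) * ∑ s, (a s i k - a s k i) ^ 2 = 2 * μ * pairExcess σ i k ∧
        ((σ i - σ k) ^ 2 - 1) * ∑ s, (a s i k + a s k i) ^ 2 = 0) := by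
  set D : ι → ι → ℝ := fun i k => ∑ s, (a s i k - a s k i) ^ 2 with hD
  set P : ι → ι → ℝ := fun i k => ∑ s, (a s i k + a s k i) ^ 2 with hP
  set A : ι → ℝ := fun i => ∑ s, a s i i ^ 2 with hA
  set t : ι → ι → ℝ := fun i k => ((σ i + σ k) ^ 2 - 1) * D i k + ((σ i - σ k) ^ 2 - 1) * P i k
    with ht
  have hsum : ∑ s, blockCommSq (diagonal σ) (a s) =
      2 * ∑ s, frobInner (a s) (a s) + 1 / 2 * ∑ i, ∑ k, t i k := by
    have h : ∑ i, ∑ k, t i k = ∑ s, ∑ i, ∑ k, (((σ i + σ k) ^ 2 - 1) * (a s i k - a s k i) ^ 2 +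
        ((σ i - σ k) ^ 2 - 1) * (a s i k + a s k i) ^ 2) := by
      rw [Finset.sum_comm (s := (Finset.univ : Finset (Fin m)))]
      refine Finset.sum_congr rfl fun i _ => ?_
      rw [Finset.sum_comm (s := (Finset.univ : Finset (Fin m)))]
      simp only [ht, hD, hP, Finset.mul_sum, Finset.sum_add_distrib]
    rw [h]
    simp only [blockCommSq_diagonal]
    rw [Finset.sum_add_distrib, Finset.mul_sum, Finset.mul_sum]
  have hD0 : ∀ i k, 0 ≤ D i k := fun i k => Finset.sum_nonneg fun _ _ => sq_nonneg _
  have hP0 : ∀ i k, 0 ≤ P i k := fun i k => Finset.sum_nonneg fun _ _ => sq_nonneg _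
  have hDle : ∀ i k, i ≠ k → D i k ≤ 2 * μ := fun i k hik => by
    -- Maximality of μ is tested on the antisymmetric unit, whose squared norm is 2.
    have h := hle (single i k 1 - single k i 1)
    simp only [frobInner_single_sub_single] at h
    simp only [Matrix.sub_apply, single_apply, hik, hik.symm, and_self, if_true, if_false] at h
    simp only [hD]
    linarith
  have hα : ∀ i k, i ≠ k → ((σ i + σ k) ^ 2 - 1) * D i k ≤ 2 * μ * pairExcess σ i k :=
    fun i k hik => by
    unfold pairExcess
    split_ifs with h
    · have := hDle i k hik
      nlinarith [h.2]
    · have h' : (σ i + σ k) ^ 2 ≤ 1 := by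
        by_contra hc; exact h ⟨hik, not_le.1 hc⟩
      nlinarith [hD0 i k]
  have hβ : ∀ i k, i ≠ k → ((σ i - σ k) ^ 2 - 1) * P i k ≤ 0 := fun i k hik => by
    have h : σ i ^ 2 + σ k ^ 2 ≤ 1 := by
      rw [← h1, ← Finset.sum_pair (f := fun j => σ j ^ 2) hik]
      exact Finset.sum_le_sum_of_subset_of_nonneg (Finset.subset_univ _) fun _ _ _ => sq_nonneg _
    have h' : (σ i - σ k) ^ 2 - 1 ≤ 0 := by nlinarith [mul_nonneg (hσ i) (hσ k)]
    exact mul_nonpos_of_nonpos_of_nonneg h' (hP0 i k)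
  have htdiag : ∀ i, t i i = -4 * A i := fun i => by
    simp only [ht, hD, hP, hA, sub_self, Finset.mul_sum, ← Finset.sum_add_distrib]
    exact Finset.sum_congr rfl fun s _ => by ring
  have hexdiag : ∀ i, pairExcess σ i i = 0 := fun i => by simp [pairExcess]
  -- Cauchy–Schwarz against the unit vector σ: only diagonal entries contribute to the inner product
  -- with diag(σ).
  have hAμ : μ ≤ ∑ i, A i := by
    rw [← heq, hA, Finset.sum_comm]
    refine Finset.sum_le_sum fun s _ => ?_
    rw [frobInner_diagonal_right]
    have := Finset.sum_mul_sq_le_sq_mul_sq Finset.univ (fun i => a s i i) σ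
    rwa [h1, mul_one] at this
  -- r is the termwise slack: nonnegative everywhere and zero on the diagonal. Equality forces its
  -- sum to be zero, hence each entry.
  set r : ι → ι → ℝ := fun i k =>
    2 * μ * pairExcess σ i k - (if i = k then 4 * A i else 0) - t i k with hr
  have hr0 : ∀ i k, 0 ≤ r i k := fun i k => by
    by_cases hik : i = k
    · subst hik
      simp only [hr, htdiag, hexdiag, if_true]; linarith
    · simp only [hr, if_neg hik, ht]
      linarith [hα i k hik, hβ i k hik]
  have hrsum : ∑ i, ∑ k, r i k =
      2 * μ * ∑ i, ∑ k, pairExcess σ i k - 4 * ∑ i, A i - ∑ i, ∑ k, t i k := by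
    simp only [hr, Finset.sum_sub_distrib, Finset.mul_sum]
    simp
  have hrs0 : 0 ≤ ∑ i, ∑ k, r i k := Finset.sum_nonneg fun i _ => Finset.sum_nonneg fun k _ => hr0 i k
  have hex := sum_pairExcess_le hσ h1
  have hexμ : μ * ∑ i, ∑ k, pairExcess σ i k ≤ μ * 2 := mul_le_mul_of_nonneg_left hex hμ
  refine ⟨by rw [hsum]; linarith, fun h => ?_⟩
  have ht0 : ∑ i, ∑ k, t i k = 0 := by linarith
  have hrz : ∑ i, ∑ k, r i k = 0 := by linarith
  have hrik : ∀ i k, r i k = 0 := fun i k => by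
    have h2 := (Finset.sum_eq_zero_iff_of_nonneg fun i _ =>
      Finset.sum_nonneg fun k _ => hr0 i k).1 hrz i (Finset.mem_univ _)
    exact (Finset.sum_eq_zero_iff_of_nonneg fun k _ => hr0 i k).1 h2 k (Finset.mem_univ _)
  refine ⟨by linarith, ?_, fun i k hik => ?_⟩
  · rw [Finset.sum_comm]
    exact le_antisymm (by linarith) hAμ
  · have h2 := hrik i k
    simp only [hr, if_neg hik, ht] at h2
    have h3 := hα i k hik
    have h4 := hβ i k hik
    exact ⟨by simp only [hD, hP] at *; linarith, by simp only [hD, hP] at *; linarith⟩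

end MatrixCommutators

/-! ### Transfer to Euclidean space and the square-matrix inequality -/

section EuclideanModel

open scoped RealInnerProductSpace

variable {ι : Type*}

/-- The matrix with given Euclidean coordinates. -/
def euclideanToMatrix (x : EuclideanSpace ℝ (ι × ι)) : Matrix ι ι ℝ := of fun i k => x (i, k)

/-- The Euclidean coordinates of a matrix. -/
def matrixToEuclidean (a : Matrix ι ι ℝ) : EuclideanSpace ℝ (ι × ι) :=
  WithLp.toLp 2 fun p => a p.1 p.2

theorem euclideanToMatrix_matrixToEuclidean (a : Matrix ι ι ℝ) :
    euclideanToMatrix (matrixToEuclidean a) = a := rfl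

theorem matrixToEuclidean_euclideanToMatrix (x : EuclideanSpace ℝ (ι × ι)) :
    matrixToEuclidean (euclideanToMatrix x) = x := rfl

variable [Fintype ι] {m : ℕ}

theorem inner_matrixToEuclidean (a b : Matrix ι ι ℝ) :
    ⟪matrixToEuclidean a, matrixToEuclidean b⟫ = frobInner a b := by
  simp [PiLp.inner_apply, matrixToEuclidean, frobInner, Fintype.sum_prod_type, mul_comm]

theorem norm_sq_matrixToEuclidean (a : Matrix ι ι ℝ) :
    ‖matrixToEuclidean a‖ ^ 2 = frobInner a a := by
  rw [← real_inner_self_eq_norm_sq, inner_matrixToEuclidean]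

/-- The two diagonal blocks of the commutator of the symmetric block matrices with corners
`x` and `y`, as a bilinear map. -/
noncomputable def blockComm : EuclideanSpace ℝ (ι × ι) →ₗ[ℝ] EuclideanSpace ℝ (ι × ι) →ₗ[ℝ]
    EuclideanSpace ℝ ((ι × ι) × Bool) :=
  LinearMap.mk₂ ℝ (fun x y => WithLp.toLp 2 fun p =>
      if p.2 then
        (euclideanToMatrix x * (euclideanToMatrix y)ᵀ -
          euclideanToMatrix y * (euclideanToMatrix x)ᵀ) p.1.1 p.1.2
      else
        ((euclideanToMatrix x)ᵀ * euclideanToMatrix y -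
          (euclideanToMatrix y)ᵀ * euclideanToMatrix x) p.1.1 p.1.2)
    (fun x x' y => by
      ext ⟨⟨i, k⟩, _ | _⟩ <;>
      simp only [Bool.false_eq_true, if_true, if_false, PiLp.add_apply, Matrix.sub_apply,
        mul_apply, transpose_apply, euclideanToMatrix, of_apply, ← Finset.sum_sub_distrib,
        ← Finset.sum_add_distrib] <;>
      exact Finset.sum_congr rfl fun _ _ => by ring)
    (fun c x y => by
      ext ⟨⟨i, k⟩, _ | _⟩ <;>
      simp only [Bool.false_eq_true, if_true, if_false, PiLp.smul_apply, Matrix.sub_apply,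
        mul_apply, transpose_apply, euclideanToMatrix, of_apply, ← Finset.sum_sub_distrib,
        smul_eq_mul, Finset.mul_sum] <;>
      exact Finset.sum_congr rfl fun _ _ => by ring)
    (fun x y y' => by
      ext ⟨⟨i, k⟩, _ | _⟩ <;>
      simp only [Bool.false_eq_true, if_true, if_false, PiLp.add_apply, Matrix.sub_apply,
        mul_apply, transpose_apply, euclideanToMatrix, of_apply, ← Finset.sum_sub_distrib,
        ← Finset.sum_add_distrib] <;>
      exact Finset.sum_congr rfl fun _ _ => by ring)
    (fun c x y => by
      ext ⟨⟨i, k⟩, _ | _⟩ <;>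
      simp only [Bool.false_eq_true, if_true, if_false, PiLp.smul_apply, Matrix.sub_apply,
        mul_apply, transpose_apply, euclideanToMatrix, of_apply, ← Finset.sum_sub_distrib,
        smul_eq_mul, Finset.mul_sum] <;>
      exact Finset.sum_congr rfl fun _ _ => by ring)

theorem blockComm_antisymm (x y : EuclideanSpace ℝ (ι × ι)) :
    blockComm y x = -blockComm x y := by
  ext ⟨⟨i, k⟩, _ | _⟩ <;> simp [blockComm]

theorem norm_sq_blockComm (a b : Matrix ι ι ℝ) :
    ‖blockComm (matrixToEuclidean a) (matrixToEuclidean b)‖ ^ 2 = blockCommSq a b := by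
  rw [EuclideanSpace.real_norm_sq_eq, Fintype.sum_prod_type, Fintype.sum_prod_type]
  simp [blockComm, blockCommSq, euclideanToMatrix_matrixToEuclidean]

/-- A direction maximizing the quadratic form of the tuple `a` on the unit sphere. -/
structure IsTopDirection (a : Fin m → Matrix ι ι ℝ) (e : Matrix ι ι ℝ) (μ : ℝ) : Prop where
  unit : frobInner e e = 1
  pos : 0 < μ
  le : ∀ x, ∑ s, frobInner (a s) x ^ 2 ≤ μ * frobInner x x
  eq : ∑ s, frobInner (a s) e ^ 2 = μ

theorem exists_isTopDirection (a : Fin m → Matrix ι ι ℝ) (ha : 0 < ∑ s, frobInner (a s) (a s)) :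
    ∃ e μ, IsTopDirection a e μ := by
  obtain ⟨e, μ, he, hμ, hle, heq⟩ := exists_top_direction (fun s => matrixToEuclidean (a s))
    (by simpa only [norm_sq_matrixToEuclidean] using ha)
  rw [← matrixToEuclidean_euclideanToMatrix e] at he heq
  refine ⟨euclideanToMatrix e, μ, ?_, hμ, fun x => ?_, ?_⟩
  · rw [← norm_sq_matrixToEuclidean, he, one_pow]
  · simpa only [norm_sq_matrixToEuclidean, inner_matrixToEuclidean] using hle (matrixToEuclidean x)
  · simpa only [inner_matrixToEuclidean] using heq

variable [DecidableEq ι]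

theorem IsTopDirection.conj {a : Fin m → Matrix ι ι ℝ} {e : Matrix ι ι ℝ} {μ : ℝ}
    (h : IsTopDirection a e μ) {U V : Matrix ι ι ℝ} (hU : U ∈ Matrix.orthogonalGroup ι ℝ)
    (hV : V ∈ Matrix.orthogonalGroup ι ℝ) :
    IsTopDirection (fun s => U * a s * Vᵀ) (U * e * Vᵀ) μ where
  unit := by rw [frobInner_conj hU hV, h.unit]
  pos := h.pos
  le x := by
    have hx : x = U * (Uᵀ * x * V) * Vᵀ := by
      simp only [Matrix.mul_assoc, mul_transpose_of_mem_orthogonalGroup hV, Matrix.mul_one]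
      rw [← Matrix.mul_assoc, mul_transpose_of_mem_orthogonalGroup hU, Matrix.one_mul]
    rw [hx]
    simp only [frobInner_conj hU hV]
    exact h.le _
  eq := by simp only [frobInner_conj hU hV, h.eq]

theorem transpose_mem_orthogonalGroup {U : Matrix ι ι ℝ} (hU : U ∈ Matrix.orthogonalGroup ι ℝ) :
    Uᵀ ∈ Matrix.orthogonalGroup ι ℝ := by
  rw [mem_orthogonalGroup_iff_transpose_mul, transpose_transpose]
  exact mul_transpose_of_mem_orthogonalGroup hU

/-- Simultaneous rotation of a tuple and of a direction making the direction diagonal. -/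
theorem IsTopDirection.exists_diagonal {a : Fin m → Matrix ι ι ℝ} {e : Matrix ι ι ℝ} {μ : ℝ}
    (h : IsTopDirection a e μ) :
    ∃ U ∈ Matrix.orthogonalGroup ι ℝ, ∃ V ∈ Matrix.orthogonalGroup ι ℝ, ∃ σ : ι → ℝ,
      ∃ b : Fin m → Matrix ι ι ℝ, (∀ i, 0 ≤ σ i) ∧ ∑ i, σ i ^ 2 = 1 ∧
        e = U * diagonal σ * Vᵀ ∧ (∀ s, a s = U * b s * Vᵀ) ∧
        IsTopDirection b (diagonal σ) μ := by
  obtain ⟨U, hU, V, hV, σ, hσ, he⟩ := exists_singular_value_decomposition e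
  have hUU := mem_orthogonalGroup_iff_transpose_mul.1 hU
  have hVV := mem_orthogonalGroup_iff_transpose_mul.1 hV
  have hUU' := mul_transpose_of_mem_orthogonalGroup hU
  have hVV' := mul_transpose_of_mem_orthogonalGroup hV
  have hd : Uᵀ * e * Vᵀᵀ = diagonal σ := by
    rw [he, transpose_transpose]
    simp only [Matrix.mul_assoc, hVV, Matrix.mul_one]
    rw [← Matrix.mul_assoc, hUU, Matrix.one_mul]
  have htop := h.conj (transpose_mem_orthogonalGroup hU) (transpose_mem_orthogonalGroup hV)
  rw [hd] at htop
  refine ⟨U, hU, V, hV, σ, fun s => Uᵀ * a s * Vᵀᵀ, hσ, ?_, he, fun s => ?_, htop⟩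
  · have := htop.unit
    rw [frobInner_diagonal_right] at this
    simpa [sq] using this
  · simp only [transpose_transpose, Matrix.mul_assoc, hVV', Matrix.mul_one]
    rw [← Matrix.mul_assoc, hUU', Matrix.one_mul]

theorem IsTopDirection.sum_blockCommSq_le {a : Fin m → Matrix ι ι ℝ} {e : Matrix ι ι ℝ} {μ : ℝ}
    (h : IsTopDirection a e μ) :
    ∑ s, blockCommSq e (a s) ≤ 2 * ∑ s, frobInner (a s) (a s) := by
  obtain ⟨U, hU, V, hV, σ, b, hσ, h1, rfl, hb, htop⟩ := h.exists_diagonal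
  simp only [hb, blockCommSq_conj hU hV, frobInner_conj hU hV]
  exact (sum_blockCommSq_diagonal_le hσ h1 b htop.pos.le htop.le htop.eq).1

theorem sum_blockCommSq_le (a : Fin m → Matrix ι ι ℝ) :
    ∑ r, ∑ s, blockCommSq (a r) (a s) ≤ 2 * (∑ s, frobInner (a s) (a s)) ^ 2 := by
  have := sum_norm_sq_le_of_top_bound (m := m) (blockComm (ι := ι)) blockComm_antisymm (K := 2)
    zero_le_two (fun a e μ he hμ hle heq => by
      have htop : IsTopDirection (fun s => euclideanToMatrix (a s)) (euclideanToMatrix e) μ := by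
        refine ⟨?_, hμ, fun x => ?_, ?_⟩
        · rw [← norm_sq_matrixToEuclidean, matrixToEuclidean_euclideanToMatrix, he, one_pow]
        · simpa only [← norm_sq_matrixToEuclidean, ← inner_matrixToEuclidean,
            matrixToEuclidean_euclideanToMatrix] using
            hle (matrixToEuclidean x)
        · simpa only [← inner_matrixToEuclidean,
            matrixToEuclidean_euclideanToMatrix] using heq
      simpa only [← norm_sq_blockComm, ← norm_sq_matrixToEuclidean,
        matrixToEuclidean_euclideanToMatrix] using htop.sum_blockCommSq_le)
    (fun s => matrixToEuclidean (a s))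
  simpa only [norm_sq_blockComm, norm_sq_matrixToEuclidean] using this

theorem IsTopDirection.sum_blockCommSq_eq {a : Fin m → Matrix ι ι ℝ} {e : Matrix ι ι ℝ} {μ : ℝ}
    (h : IsTopDirection a e μ)
    (ha : ∑ r, ∑ s, blockCommSq (a r) (a s) = 2 * (∑ s, frobInner (a s) (a s)) ^ 2) :
    ∑ s, blockCommSq e (a s) = 2 * ∑ s, frobInner (a s) (a s) := by
  have := sum_norm_sq_eq_of_extremal (blockComm (ι := ι)) blockComm_antisymm
    (fun s => matrixToEuclidean (a s)) (C := 2)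
    (fun b => by
      have := _root_.sum_blockCommSq_le fun s => euclideanToMatrix (b s)
      simpa only [← norm_sq_blockComm, ← norm_sq_matrixToEuclidean,
        matrixToEuclidean_euclideanToMatrix] using this)
    (by simpa only [norm_sq_blockComm, norm_sq_matrixToEuclidean] using ha)
    (e := matrixToEuclidean e) (μ := μ)
    (by
      have := h.unit
      rw [← norm_sq_matrixToEuclidean] at this
      exact (pow_eq_one_iff_of_nonneg (norm_nonneg _) two_ne_zero).1 this)
    h.pos
    (fun x => by
      have := h.le (euclideanToMatrix x)
      simpa only [← norm_sq_matrixToEuclidean, ← inner_matrixToEuclidean,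
            matrixToEuclidean_euclideanToMatrix] using this)
    (by simpa only [inner_matrixToEuclidean] using h.eq)
  simpa only [norm_sq_blockComm, norm_sq_matrixToEuclidean] using this

end EuclideanModel

/-! ### Equality: reduction to a plane -/

section EqualityCase

variable {ι : Type*} [Fintype ι] {m : ℕ}

theorem frobInner_add_right (a b c : Matrix ι ι ℝ) :
    frobInner a (b + c) = frobInner a b + frobInner a c := by
  simp [frobInner, mul_add, Finset.sum_add_distrib]

theorem frobInner_smul_right (t : ℝ) (a b : Matrix ι ι ℝ) :
    frobInner a (t • b) = t * frobInner a b := by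
  simp only [frobInner, Finset.mul_sum, Matrix.smul_apply, smul_eq_mul, mul_left_comm]

theorem frobInner_smul_left (t : ℝ) (a b : Matrix ι ι ℝ) :
    frobInner (t • a) b = t * frobInner a b := by
  simp only [frobInner, Finset.mul_sum, Matrix.smul_apply, smul_eq_mul, mul_assoc]

variable [DecidableEq ι]

theorem frobInner_single_right (a : Matrix ι ι ℝ) (i k : ι) :
    frobInner a (single i k 1) = a i k := by
  simp [frobInner, single_apply, ite_and]

theorem single_sub_single_mul_transpose_mul {i k : ι} (hik : i ≠ k) :
    (single i k (1 : ℝ) - single k i 1) * (single i k (1 : ℝ) - single k i 1)ᵀ *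
      (single i k (1 : ℝ) - single k i 1) = single i k (1 : ℝ) - single k i 1 := by
  simp [Matrix.sub_mul, Matrix.mul_sub, Matrix.add_mul, hik, hik.symm]

theorem conj_mul_transpose_mul_conj {U V : Matrix ι ι ℝ} (hU : U ∈ Matrix.orthogonalGroup ι ℝ)
    (hV : V ∈ Matrix.orthogonalGroup ι ℝ) (e : Matrix ι ι ℝ) :
    (U * e * Vᵀ) * (U * e * Vᵀ)ᵀ * (U * e * Vᵀ) = U * (e * eᵀ * e) * Vᵀ := by
  have hUU := mem_orthogonalGroup_iff_transpose_mul.1 hU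
  have hVV := mem_orthogonalGroup_iff_transpose_mul.1 hV
  simp only [transpose_mul, transpose_transpose, Matrix.mul_assoc]
  rw [← Matrix.mul_assoc Vᵀ V, hVV, Matrix.one_mul, ← Matrix.mul_assoc Uᵀ U, hUU, Matrix.one_mul]

/-- Equality makes the total excess equal to 2, so some pair has σ_i + σ_k > 1, and there the bound
2μ on the antisymmetric part is attained. The normalized antisymmetric unit is therefore itself a
top direction. The cubic identity says that its nonzero singular values are 1/√2, in a form stable
under a ↦ U a Vᵀ. -/
theorem IsTopDirection.exists_half_isometry {a : Fin m → Matrix ι ι ℝ} {e : Matrix ι ι ℝ} {μ : ℝ}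
    (h : IsTopDirection a e μ)
    (ha : ∑ r, ∑ s, blockCommSq (a r) (a s) = 2 * (∑ s, frobInner (a s) (a s)) ^ 2) :
    ∃ e', IsTopDirection a e' μ ∧ e' * e'ᵀ * e' = (1 / 2 : ℝ) • e' := by
  have heq := h.sum_blockCommSq_eq ha
  obtain ⟨U, hU, V, hV, σ, b, hσ, h1, rfl, hb, htop⟩ := h.exists_diagonal
  simp only [hb, blockCommSq_conj hU hV, frobInner_conj hU hV] at heq
  obtain ⟨hex, -, hD⟩ := (sum_blockCommSq_diagonal_le hσ h1 b htop.pos.le htop.le htop.eq).2 heq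
  have hex2 : ∑ i, ∑ k, pairExcess σ i k ≠ 0 := fun h0 => by
    rw [h0] at hex
    have := htop.pos
    linarith
  obtain ⟨i, -, hi⟩ := Finset.exists_ne_zero_of_sum_ne_zero hex2
  obtain ⟨k, -, hk⟩ := Finset.exists_ne_zero_of_sum_ne_zero hi
  have hcond : i ≠ k ∧ 1 < (σ i + σ k) ^ 2 := by
    by_contra hc
    exact hk (by unfold pairExcess; rw [if_neg hc])
  have hDik : ∑ s, (b s i k - b s k i) ^ 2 = 2 * μ := by
    have h2 := (hD i k hcond.1).1
    unfold pairExcess at h2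
    rw [if_pos hcond, mul_comm] at h2
    exact mul_right_cancel₀ (by linarith [hcond.2] : (σ i + σ k) ^ 2 - 1 ≠ 0) h2
  have h2 : (√2)⁻¹ * (√2)⁻¹ = (1 / 2 : ℝ) := by
    rw [← mul_inv, Real.mul_self_sqrt zero_le_two, one_div]
  set N : Matrix ι ι ℝ := single i k 1 - single k i 1 with hN
  have hNN : frobInner N N = 2 := by
    rw [hN, frobInner_single_sub_single]
    simp [hcond.1, hcond.1.symm]
    norm_num
  have hε : IsTopDirection b ((√2)⁻¹ • N) μ := by
    refine ⟨?_, htop.pos, htop.le, ?_⟩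
    · rw [frobInner_smul_left, frobInner_smul_right, hNN, ← mul_assoc, h2]; norm_num
    · simp only [frobInner_smul_right, hN, frobInner_single_sub_single, mul_pow, ← Finset.mul_sum,
        hDik]
      rw [sq, h2]; ring
  have hcube : ((√2)⁻¹ • N) * ((√2)⁻¹ • N)ᵀ * ((√2)⁻¹ • N) = (1 / 2 : ℝ) • ((√2)⁻¹ • N) := by
    simp only [transpose_smul, Matrix.smul_mul, Matrix.mul_smul, smul_smul]
    rw [hN, single_sub_single_mul_transpose_mul hcond.1, ← h2, mul_assoc]
  refine ⟨U * ((√2)⁻¹ • N) * Vᵀ, ?_, ?_⟩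
  · have := hε.conj hU hV
    rwa [show (fun s => U * b s * Vᵀ) = a from funext fun s => (hb s).symm] at this
  · rw [conj_mul_transpose_mul_conj hU hV, hcube, Matrix.mul_smul, Matrix.smul_mul]

theorem exists_pair_of_sq_eq_half {σ : ι → ℝ} (h1 : ∑ i, σ i ^ 2 = 1)
    (hσ : ∀ i, σ i = 0 ∨ σ i ^ 2 = 1 / 2) :
    ∃ i k, i ≠ k ∧ σ i ^ 2 = 1 / 2 ∧ σ k ^ 2 = 1 / 2 ∧ ∀ j, j ≠ i → j ≠ k → σ j = 0 := by
  obtain ⟨i, -, hi⟩ : ∃ i ∈ Finset.univ, σ i ^ 2 ≠ 0 :=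
    Finset.exists_ne_zero_of_sum_ne_zero (by rw [h1]; exact one_ne_zero)
  have hi2 : σ i ^ 2 = 1 / 2 := (hσ i).resolve_left fun h => hi (by rw [h]; norm_num)
  have hsum : ∑ j ∈ Finset.univ.erase i, σ j ^ 2 = 1 / 2 := by
    have := Finset.add_sum_erase Finset.univ (fun j => σ j ^ 2) (Finset.mem_univ i)
    linarith
  obtain ⟨k, hk, hk0⟩ := Finset.exists_ne_zero_of_sum_ne_zero
    (by rw [hsum]; norm_num : ∑ j ∈ Finset.univ.erase i, σ j ^ 2 ≠ 0)
  have hk2 : σ k ^ 2 = 1 / 2 := (hσ k).resolve_left fun h => hk0 (by rw [h]; norm_num)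
  have hsum' : ∑ j ∈ (Finset.univ.erase i).erase k, σ j ^ 2 = 0 := by
    have := Finset.add_sum_erase (Finset.univ.erase i) (fun j => σ j ^ 2) hk
    linarith
  refine ⟨i, k, (Finset.ne_of_mem_erase hk).symm, hi2, hk2, fun j hji hjk => ?_⟩
  have := (Finset.sum_eq_zero_iff_of_nonneg fun _ _ => sq_nonneg _).1 hsum' j (by simp [hji, hjk])
  simpa using this

/-- Extremal tuples are, up to rotation, spanned by an identity and a quarter turn in a plane. -/
theorem exists_plane_form {a : Fin m → Matrix ι ι ℝ} (hpos : 0 < ∑ s, frobInner (a s) (a s))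
    (ha : ∑ r, ∑ s, blockCommSq (a r) (a s) = 2 * (∑ s, frobInner (a s) (a s)) ^ 2) :
    ∃ U ∈ Matrix.orthogonalGroup ι ℝ, ∃ V ∈ Matrix.orthogonalGroup ι ℝ, ∃ i k : ι, i ≠ k ∧
      ∃ (ν : ℝ) (y z : Fin m → ℝ), 0 < ν ∧ ∑ s, y s ^ 2 = ν ∧ ∑ s, z s ^ 2 = ν ∧
        ∑ s, y s * z s = 0 ∧
        ∀ s, a s = U * (y s • (single i i 1 + single k k 1) +
          z s • (single i k 1 - single k i 1)) * Vᵀ := by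
  obtain ⟨e₀, μ, h₀⟩ := exists_isTopDirection a hpos
  obtain ⟨e, h, hcube⟩ := h₀.exists_half_isometry ha
  have heq := h.sum_blockCommSq_eq ha
  obtain ⟨U, hU, V, hV, σ, b, hσ, h1, rfl, hb, htop⟩ := h.exists_diagonal
  simp only [hb, blockCommSq_conj hU hV, frobInner_conj hU hV] at heq
  obtain ⟨-, hdiag, hoff⟩ := (sum_blockCommSq_diagonal_le hσ h1 b htop.pos.le htop.le htop.eq).2 heq
  have hcubeσ : ∀ i, σ i * σ i * σ i = 1 / 2 * σ i := fun i => by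
    rw [conj_mul_transpose_mul_conj hU hV, ← Matrix.smul_mul, ← Matrix.mul_smul] at hcube
    have hc := congrArg (fun x => Uᵀ * (x * V)) hcube
    have hUU := mem_orthogonalGroup_iff_transpose_mul.1 hU
    have hVV := mem_orthogonalGroup_iff_transpose_mul.1 hV
    simp only [Matrix.mul_assoc, hVV, Matrix.mul_one] at hc
    rw [← Matrix.mul_assoc, ← Matrix.mul_assoc Uᵀ, hUU, Matrix.one_mul, Matrix.one_mul] at hc
    have := congrFun (congrFun hc i) i
    simpa [mul_assoc] using this
  have hσ01 : ∀ i, σ i = 0 ∨ σ i ^ 2 = 1 / 2 := fun i => by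
    rcases eq_or_ne (σ i) 0 with h0 | h0
    · exact Or.inl h0
    · right
      rw [sq]
      exact mul_right_cancel₀ h0 (hcubeσ i)
  obtain ⟨i, k, hik, hi2, hk2, hj⟩ := exists_pair_of_sq_eq_half h1 hσ01
  have hσik : σ k = σ i := (sq_eq_sq₀ (hσ k) (hσ i)).1 (by rw [hi2, hk2])
  have hzero : ∀ f : Fin m → ℝ, ∑ s, f s ^ 2 = 0 → ∀ s, f s = 0 := fun f hf s => by
    simpa using (Finset.sum_eq_zero_iff_of_nonneg fun s _ => sq_nonneg (f s)).1 hf s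
      (Finset.mem_univ s)
  have hsq : ∀ j, σ j ^ 2 ≤ 1 / 2 := fun j => by
    rcases hσ01 j with h0 | h0
    · rw [h0]; norm_num
    · exact h0.le
  -- Each σ_j is 0 or 1/√2, so (σ_j - σ_l)² ≤ 1/2 is never 1 and the symmetric off-diagonal parts
  -- vanish.
  have hP : ∀ j l, j ≠ l → ∀ s, b s l j = -b s j l := fun j l hjl s => by
    have hβ : (σ j - σ l) ^ 2 - 1 ≠ 0 := by
      rcases hσ01 j with h0 | h0
      · rw [h0]; have := hsq l; nlinarith
      · rcases hσ01 l with h0' | h0'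
        · rw [h0']; have := hsq j; nlinarith
        · have : σ j = σ l := (sq_eq_sq₀ (hσ j) (hσ l)).1 (by rw [h0, h0'])
          rw [this]; norm_num
    have := hzero _ ((mul_eq_zero.1 (hoff j l hjl).2).resolve_left hβ) s
    linarith
  -- Outside the pair {i, k} there is no excess and (σ_j + σ_l)² < 1, so the antisymmetric part
  -- vanishes as well.
  have hDz : ∀ j l, j ≠ l → (σ j = 0 ∨ σ l = 0) → ∀ s, b s j l = 0 := fun j l hjl h0 s => by
    have hα : (σ j + σ l) ^ 2 < 1 := by
      rcases h0 with h0 | h0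
      · rw [h0, zero_add]; linarith [hsq l]
      · rw [h0, add_zero]; linarith [hsq j]
    have h2 := (hoff j l hjl).1
    unfold pairExcess at h2
    rw [if_neg fun hc => by linarith [hc.2], mul_zero] at h2
    have := hzero _ ((mul_eq_zero.1 h2).resolve_left (by linarith)) s
    linarith [hP j l hjl s]
  set y : Fin m → ℝ := fun s => b s i i with hy
  set z : Fin m → ℝ := fun s => b s i k with hz
  -- This is the equality case of the Cauchy–Schwarz step: the diagonals carry total mass exactly μ,
  -- so each is a multiple of σ.
  have hdiagσ : ∀ s j, b s j j = (∑ l, b s l l * σ l) * σ j := by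
    have hexp : ∀ s, ∑ j, (b s j j - (∑ l, b s l l * σ l) * σ j) ^ 2 =
        ∑ j, b s j j ^ 2 - (∑ l, b s l l * σ l) ^ 2 := fun s => by
      have : ∀ t : ℝ, ∑ j, (b s j j - t * σ j) ^ 2 =
          ∑ j, b s j j ^ 2 - 2 * t * ∑ l, b s l l * σ l + t ^ 2 * ∑ j, σ j ^ 2 := fun t => by
        simp only [Finset.mul_sum, ← Finset.sum_sub_distrib, ← Finset.sum_add_distrib]
        exact Finset.sum_congr rfl fun _ _ => by ring
      rw [this, h1]; ring
    have hsum : ∑ s, ∑ j, (b s j j - (∑ l, b s l l * σ l) * σ j) ^ 2 = 0 := by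
      have he := htop.eq
      simp only [frobInner_diagonal_right] at he
      simp only [hexp, Finset.sum_sub_distrib, hdiag, he, sub_self]
    intro s j
    have h2 := (Finset.sum_eq_zero_iff_of_nonneg fun s _ =>
      Finset.sum_nonneg fun j _ => sq_nonneg _).1 hsum s (Finset.mem_univ _)
    have h3 := (Finset.sum_eq_zero_iff_of_nonneg fun j _ => sq_nonneg _).1 h2 j (Finset.mem_univ _)
    have h4 := pow_eq_zero_iff (two_ne_zero) |>.1 h3
    linarith
  have hdiagz : ∀ s j, j ≠ i → j ≠ k → b s j j = 0 := fun s j h2 h3 => by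
    rw [hdiagσ, hj j h2 h3, mul_zero]
  have hykk : ∀ s, b s k k = y s := fun s => by
    rw [hdiagσ s k, hσik, ← hdiagσ s i]
  have hform : ∀ s, b s = y s • (single i i 1 + single k k 1) +
      z s • (single i k 1 - single k i 1) := fun s => by
    ext j l
    simp only [Matrix.add_apply, Matrix.smul_apply, Matrix.sub_apply, single_apply, smul_eq_mul]
    by_cases hji : j = i
    · subst hji
      by_cases hlj : l = j
      · subst hlj; simp [hik.symm, hy]
      · by_cases hlk : l = k
        · subst hlk; simp [hik.symm, hik, hz]
        · rw [hDz j l (Ne.symm hlj) (Or.inr (hj l hlj hlk))]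
          simp [Ne.symm hlj, Ne.symm hlk, hik.symm]
    · by_cases hjk : j = k
      · subst hjk
        by_cases hli : l = i
        · subst hli; simp [hik, hik.symm, hz, hP l j hik]
        · by_cases hlj : l = j
          · subst hlj; simp [hik, hykk]
          · rw [hDz j l (Ne.symm hlj) (Or.inr (hj l hli hlj))]
            simp [Ne.symm hlj, Ne.symm hli, hik]
      · by_cases hlj : l = j
        · subst hlj
          rw [hdiagz s l hji hjk]
          simp [Ne.symm hji, Ne.symm hjk]
        · rw [hDz j l (Ne.symm hlj) (Or.inl (hj j hji hjk))]
          simp [Ne.symm hji, Ne.symm hjk]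
  have hyy : ∑ s, y s ^ 2 = μ / 2 := by
    have : ∀ s, ∑ j, b s j j ^ 2 = 2 * y s ^ 2 := fun s => by
      rw [← Finset.sum_subset (Finset.subset_univ {i, k}) (fun j _ hjn => by
        simp only [Finset.mem_insert, Finset.mem_singleton, not_or] at hjn
        rw [hdiagz s j hjn.1 hjn.2]; norm_num), Finset.sum_pair hik, hykk]
      ring
    simp only [this, ← Finset.mul_sum] at hdiag
    linarith
  have hzz : ∑ s, z s ^ 2 = μ / 2 := by
    have h2 := (hoff i k hik).1
    have h4 : (σ i + σ k) ^ 2 = 2 := by rw [hσik]; linarith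
    unfold pairExcess at h2
    rw [if_pos ⟨hik, by rw [h4]; norm_num⟩, h4] at h2
    have h5 : ∀ s, (b s i k - b s k i) ^ 2 = 4 * z s ^ 2 := fun s => by
      rw [hP i k hik s]; simp only [hz]; ring
    simp only [h5, ← Finset.mul_sum] at h2
    linarith
  -- Identity and quarter turn already attain μ separately. Testing maximality on their sum and
  -- difference, of squared norm 4, leaves no room for a cross term of either sign.
  have hcross : ∀ t : ℝ, t ^ 2 = 1 → t * ∑ s, y s * z s ≤ 0 := fun t ht => by
    have h2 := htop.le (single i i 1 + single k k 1 + t • (single i k 1 + (-1 : ℝ) • single k i 1))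
    simp only [frobInner_add_right, frobInner_smul_right, frobInner_single_right] at h2
    have h3 : ∀ s, (b s i i + b s k k + t * (b s i k + -1 * b s k i)) ^ 2 =
        4 * y s ^ 2 + 8 * (t * (y s * z s)) + 4 * z s ^ 2 := fun s => by
      rw [hykk, hP i k hik s]; simp only [hy, hz]
      linear_combination 4 * b s i k ^ 2 * ht
    simp only [h3, Finset.sum_add_distrib, ← Finset.mul_sum, hyy, hzz] at h2
    simp [hik, hik.symm] at h2
    nlinarith [htop.pos]
  refine ⟨U, hU, V, hV, i, k, hik, μ / 2, y, z, by linarith [htop.pos], hyy, hzz, ?_, fun s => ?_⟩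
  · have h2 := hcross 1 (by norm_num)
    have h3 := hcross (-1) (by norm_num)
    linarith
  · rw [hb, ← hform]

end EqualityCase

/-! ### Invariance under the action of O(n) × O(m) -/

section ActionInvariance

variable {n m : ℕ}

theorem frobSq_eq_frobInner (B : Matrix (Fin n) (Fin n) ℝ) : frobSq B = frobInner B B :=
  (frobInner_eq_trace B B).symm

theorem sum_sq_rotation {R : Matrix (Fin m) (Fin m) ℝ} (hR : R ∈ Matrix.orthogonalGroup (Fin m) ℝ)
    (f : Fin m → ℝ) : ∑ k, (∑ j, R j k * f j) ^ 2 = ∑ j, f j ^ 2 := by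
  have h : (f ᵥ* R) ⬝ᵥ (f ᵥ* R) = f ⬝ᵥ f := by
    rw [← dotProduct_mulVec, ← vecMul_transpose, vecMul_vecMul,
      mul_transpose_of_mem_orthogonalGroup hR, vecMul_one]
  simpa [dotProduct, vecMul, sq, mul_comm] using h

theorem sum_frobSq_rotation {R : Matrix (Fin m) (Fin m) ℝ}
    (hR : R ∈ Matrix.orthogonalGroup (Fin m) ℝ) (D : Fin m → Matrix (Fin n) (Fin n) ℝ) :
    ∑ k, frobSq (∑ j, R j k • D j) = ∑ j, frobSq (D j) := by
  simp only [frobSq_eq_frobInner, frobInner_self_eq, Matrix.sum_apply, Matrix.smul_apply,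
    smul_eq_mul]
  rw [Finset.sum_comm, Finset.sum_comm (s := (Finset.univ : Finset (Fin m)))]
  refine Finset.sum_congr rfl fun i _ => ?_
  rw [Finset.sum_comm, Finset.sum_comm (s := (Finset.univ : Finset (Fin m)))]
  exact Finset.sum_congr rfl fun k _ => sum_sq_rotation hR _

theorem matComm_sum_smul_left (c : Fin m → ℝ) (D : Fin m → Matrix (Fin n) (Fin n) ℝ)
    (A : Matrix (Fin n) (Fin n) ℝ) :
    matComm (∑ j, c j • D j) A = ∑ j, c j • matComm (D j) A := by
  simp only [matComm, Finset.sum_mul, Finset.mul_sum, Matrix.smul_mul, Matrix.mul_smul, smul_sub,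
    Finset.sum_sub_distrib]

theorem matComm_sum_smul_right (c : Fin m → ℝ) (D : Fin m → Matrix (Fin n) (Fin n) ℝ)
    (A : Matrix (Fin n) (Fin n) ℝ) :
    matComm A (∑ j, c j • D j) = ∑ j, c j • matComm A (D j) := by
  simp only [matComm, Finset.sum_mul, Finset.mul_sum, Matrix.smul_mul, Matrix.mul_smul, smul_sub,
    Finset.sum_sub_distrib]

theorem frobSq_conj {P : Matrix (Fin n) (Fin n) ℝ} (hP : P ∈ Matrix.orthogonalGroup (Fin n) ℝ)
    (A : Matrix (Fin n) (Fin n) ℝ) : frobSq (Pᵀ * A * P) = frobSq A := by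
  have hP' := transpose_mem_orthogonalGroup hP
  have := frobInner_conj hP' hP' A A
  rwa [transpose_transpose, ← frobSq_eq_frobInner, ← frobSq_eq_frobInner] at this

theorem matComm_conj {P : Matrix (Fin n) (Fin n) ℝ} (hP : P ∈ Matrix.orthogonalGroup (Fin n) ℝ)
    (A B : Matrix (Fin n) (Fin n) ℝ) :
    matComm (Pᵀ * A * P) (Pᵀ * B * P) = Pᵀ * matComm A B * P := by
  have h : ∀ A B : Matrix (Fin n) (Fin n) ℝ, Pᵀ * A * P * (Pᵀ * B * P) = Pᵀ * (A * B) * P :=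
    fun A B => by
      simp only [Matrix.mul_assoc]
      rw [← Matrix.mul_assoc P Pᵀ, mul_transpose_of_mem_orthogonalGroup hP, Matrix.one_mul]
  rw [matComm, matComm, h, h, Matrix.mul_sub, Matrix.sub_mul]

theorem sum_frobSq_kAct {P : Matrix (Fin n) (Fin n) ℝ} {R : Matrix (Fin m) (Fin m) ℝ}
    (hP : P ∈ Matrix.orthogonalGroup (Fin n) ℝ) (hR : R ∈ Matrix.orthogonalGroup (Fin m) ℝ)
    (B : Fin m → Matrix (Fin n) (Fin n) ℝ) :
    ∑ r, frobSq (kAct P R B r) = ∑ r, frobSq (B r) := by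
  simp only [kAct]
  rw [sum_frobSq_rotation hR]
  simp only [frobSq_conj hP]

theorem sum_frobSq_matComm_kAct {P : Matrix (Fin n) (Fin n) ℝ} {R : Matrix (Fin m) (Fin m) ℝ}
    (hP : P ∈ Matrix.orthogonalGroup (Fin n) ℝ) (hR : R ∈ Matrix.orthogonalGroup (Fin m) ℝ)
    (B : Fin m → Matrix (Fin n) (Fin n) ℝ) :
    ∑ r, ∑ s, frobSq (matComm (kAct P R B r) (kAct P R B s)) =
      ∑ r, ∑ s, frobSq (matComm (B r) (B s)) := by
  simp only [kAct, matComm_sum_smul_right, sum_frobSq_rotation hR]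
  rw [Finset.sum_comm]
  simp only [matComm_sum_smul_left, sum_frobSq_rotation hR, matComm_conj hP, frobSq_conj hP]
  rw [Finset.sum_comm]

end ActionInvariance

/-! ### The model tuple attains equality -/

section Model

variable {n m : ℕ}

/-- The inclusion of the first four coordinates. -/
def firstFour (n : ℕ) : Matrix (Fin n) (Fin 4) ℝ :=
  of fun i a => if i.val = a.val then 1 else 0

theorem firstFour_apply_of_le (h : 4 ≤ n) (i : Fin n) (a : Fin 4) :
    firstFour n i a = if i = Fin.castLE h a then 1 else 0 := by
  simp [firstFour, Fin.ext_iff]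

theorem firstFour_transpose_mul (h : 4 ≤ n) : (firstFour n)ᵀ * firstFour n = 1 := by
  ext a b
  simp only [mul_apply, transpose_apply, firstFour_apply_of_le h, ite_mul, one_mul, zero_mul, Finset.sum_ite_eq',
    Finset.mem_univ, if_true, one_apply, Fin.castLE_inj]

theorem diagZero_eq (n : ℕ) (C : Matrix (Fin 4) (Fin 4) ℝ) :
    diagZero n C = firstFour n * C * (firstFour n)ᵀ := by
  have h0 : ∀ (i : Fin n), ¬ i.val < 4 → ∀ a : Fin 4, firstFour n i a = 0 := fun i hi a => by
    simp only [firstFour, of_apply, ite_eq_right_iff]; intro h; omega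
  have h1 : ∀ (i : Fin n) (hi : i.val < 4) (a : Fin 4),
      firstFour n i a = if a = ⟨i.val, hi⟩ then 1 else 0 := fun i hi a => by
    simp [firstFour, Fin.ext_iff, eq_comm]
  ext i j
  by_cases hi : i.val < 4
  · by_cases hj : j.val < 4
    · simp [diagZero, mul_apply, hi, hj, h1 i hi, h1 j hj]
    · simp [diagZero, mul_apply, hj, h0 j hj]
  · simp [diagZero, mul_apply, hi, h0 i hi]

theorem matComm_diagZero (h : 4 ≤ n) (C D : Matrix (Fin 4) (Fin 4) ℝ) :
    matComm (diagZero n C) (diagZero n D) = diagZero n (matComm C D) := by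
  have hm : ∀ C D : Matrix (Fin 4) (Fin 4) ℝ,
      diagZero n C * diagZero n D = diagZero n (C * D) := fun C D => by
    simp only [diagZero_eq, Matrix.mul_assoc]
    rw [← Matrix.mul_assoc (firstFour n)ᵀ, firstFour_transpose_mul h, Matrix.one_mul]
  rw [matComm, hm, hm, matComm]
  simp only [diagZero_eq, Matrix.mul_sub, Matrix.sub_mul]

theorem frobSq_diagZero (h : 4 ≤ n) (C : Matrix (Fin 4) (Fin 4) ℝ) :
    frobSq (diagZero n C) = frobSq C := by
  have : diagZero n C * (diagZero n C)ᵀ = firstFour n * (C * Cᵀ * (firstFour n)ᵀ) := by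
    simp only [diagZero_eq, transpose_mul, transpose_transpose, Matrix.mul_assoc]
    rw [← Matrix.mul_assoc (firstFour n)ᵀ, firstFour_transpose_mul h, Matrix.one_mul]
  rw [frobSq, this, trace_mul_comm, Matrix.mul_assoc, firstFour_transpose_mul h, Matrix.mul_one,
    frobSq]

theorem frobSq_matC1 : frobSq matC1 = 4 := by
  simp [frobSq_eq_frobInner, frobInner, matC1, Fin.sum_univ_four]; norm_num

theorem frobSq_matC2 : frobSq matC2 = 4 := by
  simp [frobSq_eq_frobInner, frobInner, matC2, Fin.sum_univ_four]; norm_num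

theorem frobSq_matComm_matC1_matC2 : frobSq (matComm matC1 matC2) = 16 := by
  simp only [frobSq_eq_frobInner, frobInner, matComm, Matrix.sub_apply, mul_apply,
    Fin.sum_univ_four]
  simp [matC1, matC2]
  norm_num

theorem frobSq_smul (c : ℝ) (A : Matrix (Fin n) (Fin n) ℝ) : frobSq (c • A) = c ^ 2 * frobSq A := by
  rw [frobSq_eq_frobInner, frobInner_smul_left, frobInner_smul_right, frobSq_eq_frobInner]; ring

theorem frobSq_neg (A : Matrix (Fin n) (Fin n) ℝ) : frobSq (-A) = frobSq A := by
  simp [frobSq]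

theorem matComm_smul_smul (c : ℝ) (A B : Matrix (Fin n) (Fin n) ℝ) :
    matComm (c • A) (c • B) = c ^ 2 • matComm A B := by
  simp [matComm, smul_sub, smul_smul, sq]

theorem modelTuple_equality (hn : 4 ≤ n) (hm : 2 ≤ m) :
    ∑ r, ∑ s, frobSq (matComm (modelTuple n m r) (modelTuple n m s)) =
      (1 / 2 : ℝ) * (∑ r, frobSq (modelTuple n m r)) ^ 2 := by
  obtain ⟨m, rfl⟩ := Nat.exists_eq_add_of_le' hm
  have h0 : frobSq (0 : Matrix (Fin n) (Fin n) ℝ) = 0 := by simp [frobSq]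
  have hl : ∀ A : Matrix (Fin n) (Fin n) ℝ, matComm 0 A = 0 := fun A => by simp [matComm]
  have hr : ∀ A : Matrix (Fin n) (Fin n) ℝ, matComm A 0 = 0 := fun A => by simp [matComm]
  have hs : ∀ A : Matrix (Fin n) (Fin n) ℝ, matComm A A = 0 := fun A => by simp [matComm]
  have h21 : matComm (diagZero n matC2) (diagZero n matC1) =
      -matComm (diagZero n matC1) (diagZero n matC2) := by simp [matComm]
  simp [Fin.sum_univ_succ, modelTuple, h0, hl, hr, hs, h21, frobSq_neg, matComm_diagZero hn,
    frobSq_diagZero hn, frobSq_matC1, frobSq_matC2, frobSq_matComm_matC1_matC2]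
  norm_num

/-- Both sides are invariant under the action and scale by c⁴. The condition `hc` matters because
for n < 4 or m < 2 `modelTuple` is a truncation of the intended tuple, admissible only with c = 0.
-/
theorem equality_of_kAct_eq_modelTuple {P : Matrix (Fin n) (Fin n) ℝ}
    {R : Matrix (Fin m) (Fin m) ℝ} (hP : P ∈ Matrix.orthogonalGroup (Fin n) ℝ)
    (hR : R ∈ Matrix.orthogonalGroup (Fin m) ℝ) {B : Fin m → Matrix (Fin n) (Fin n) ℝ} {c : ℝ}
    (hc : c ≠ 0 → 4 ≤ n ∧ 2 ≤ m) (h : kAct P R B = c • modelTuple n m) :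
    ∑ r, ∑ s, frobSq (matComm (B r) (B s)) = (1 / 2 : ℝ) * (∑ r, frobSq (B r)) ^ 2 := by
  rw [← sum_frobSq_matComm_kAct hP hR, ← sum_frobSq_kAct hP hR, h]
  simp only [Pi.smul_apply, matComm_smul_smul, frobSq_smul, ← Finset.mul_sum]
  rcases eq_or_ne c 0 with rfl | h0
  · simp
  · rw [modelTuple_equality (hc h0).1 (hc h0).2]; ring

end Model

/-! ### From symmetric block matrices to corners -/

section Reduction

variable {n m : ℕ}

theorem frobSq_add_transpose {a : Matrix (Fin n) (Fin n) ℝ} (h : a * a = 0) :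
    frobSq (a + aᵀ) = 2 * frobInner a a := by
  have h' : aᵀ * aᵀ = 0 := by rw [← transpose_mul, h, transpose_zero]
  rw [frobSq, frobInner_eq_trace, transpose_add, transpose_transpose, Matrix.add_mul,
    Matrix.mul_add, Matrix.mul_add, h, h', zero_add, add_zero, trace_add, trace_mul_comm aᵀ]
  ring

/-- The vanishing products leave the commutator as X + Y, the two diagonal blocks, and also give X
Yᵀ = 0, so the squared norms add. -/
theorem frobSq_matComm_add_transpose {a b : Matrix (Fin n) (Fin n) ℝ} (haa : a * a = 0)
    (hab : a * b = 0) (hba : b * a = 0) (hbb : b * b = 0) :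
    frobSq (matComm (a + aᵀ) (b + bᵀ)) = blockCommSq a b := by
  have haa' : aᵀ * aᵀ = 0 := by rw [← transpose_mul, haa, transpose_zero]
  have hab' : aᵀ * bᵀ = 0 := by rw [← transpose_mul, hba, transpose_zero]
  have hba' : bᵀ * aᵀ = 0 := by rw [← transpose_mul, hab, transpose_zero]
  have hbb' : bᵀ * bᵀ = 0 := by rw [← transpose_mul, hbb, transpose_zero]
  set X := a * bᵀ - b * aᵀ with hX
  set Y := aᵀ * b - bᵀ * a with hY
  have h : matComm (a + aᵀ) (b + bᵀ) = X + Y := by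
    rw [matComm, hX, hY]
    simp only [Matrix.add_mul, Matrix.mul_add, hab, hab', hba, hba']
    abel
  have hXY : X * Yᵀ = 0 := by
    rw [hX, hY]
    simp only [transpose_sub, transpose_mul, transpose_transpose, Matrix.sub_mul, Matrix.mul_sub,
      Matrix.mul_assoc]
    simp only [← Matrix.mul_assoc aᵀ, ← Matrix.mul_assoc bᵀ, haa', hab', hba', hbb',
      Matrix.zero_mul, Matrix.mul_zero, sub_zero]
  have hYX : Y * Xᵀ = 0 := by
    rw [← transpose_transpose Y, ← transpose_mul, hXY, transpose_zero]
  rw [h, blockCommSq_eq, frobInner_eq_trace, frobInner_eq_trace, frobSq, transpose_add,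
    Matrix.add_mul, Matrix.mul_add, Matrix.mul_add, hXY, hYX, add_zero, zero_add, trace_add]

/-- Padding the p × q corner to a square matrix keeps a single index type. The block position is
remembered only through the vanishing products. -/
theorem exists_corner {p q : ℕ} {B : Fin m → Matrix (Fin (p + q)) (Fin (p + q)) ℝ}
    (hB : ∀ r, B r ∈ austereQ p q) :
    ∃ a : Fin m → Matrix (Fin (p + q)) (Fin (p + q)) ℝ,
      (∀ r, B r = a r + (a r)ᵀ) ∧ ∀ r s, a r * a s = 0 := by
  choose α hα using hB
  refine ⟨fun r => Matrix.reindex finSumFinEquiv finSumFinEquiv (Matrix.fromBlocks 0 (α r) 0 0),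
    fun r => ?_, fun r s => ?_⟩
  · rw [hα]
    ext i j
    obtain ⟨i, rfl⟩ := finSumFinEquiv.surjective i
    obtain ⟨j, rfl⟩ := finSumFinEquiv.surjective j
    rcases i with i | i <;> rcases j with j | j <;>
      simp only [reindex_apply, Matrix.add_apply, transpose_apply, submatrix_apply,
        Equiv.symm_apply_apply] <;> simp
  · simp only [reindex_apply, Matrix.submatrix_mul_equiv, fromBlocks_multiply]
    simp

end Reduction

/-! ### Normal form of extremal tuples -/

section NormalForm

variable {n m : ℕ}

theorem four_le_of_orthonormal_columns {W : Matrix (Fin n) (Fin 4) ℝ} (hW : Wᵀ * W = 1) :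
    4 ≤ n := by
  have h1 := Matrix.rank_mul_le_right Wᵀ W
  have h2 := W.rank_le_card_height
  rw [hW, Matrix.rank_one, Fintype.card_fin] at h1
  rw [Fintype.card_fin] at h2
  omega

theorem exists_orthogonal_mul_firstFour {W : Matrix (Fin n) (Fin 4) ℝ} (hW : Wᵀ * W = 1) :
    ∃ P ∈ Matrix.orthogonalGroup (Fin n) ℝ, P * firstFour n = W := by
  have hn := four_le_of_orthonormal_columns hW
  obtain ⟨P, hP, hPW⟩ := exists_orthogonal_extension
    (fun (j x : Fin n) => if h : j.val < 4 then W x ⟨j.val, h⟩ else 0) {j | j.val < 4}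
    (fun i hi j hj => by
      have hi' : i.val < 4 := hi
      have hj' : j.val < 4 := hj
      have := congrFun (congrFun hW ⟨i.val, hi'⟩) ⟨j.val, hj'⟩
      simp only [hi', hj', dif_pos, dotProduct]
      simpa [mul_apply, one_apply, Fin.ext_iff] using this)
  refine ⟨P, hP, ?_⟩
  ext x a
  have := hPW (Fin.castLE hn a) (by simp) x
  simp [mul_apply, firstFour_apply_of_le hn, this]

theorem transpose_mul_conj_mul_eq_diagZero {P : Matrix (Fin n) (Fin n) ℝ}
    (hP : P ∈ Matrix.orthogonalGroup (Fin n) ℝ) (C : Matrix (Fin 4) (Fin 4) ℝ) :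
    Pᵀ * ((P * firstFour n) * C * (P * firstFour n)ᵀ) * P = diagZero n C := by
  have hPP := mem_orthogonalGroup_iff_transpose_mul.1 hP
  rw [diagZero_eq]
  simp only [transpose_mul, Matrix.mul_assoc]
  rw [hPP, Matrix.mul_one, ← Matrix.mul_assoc Pᵀ P, hPP, Matrix.one_mul]

theorem mul_single_mul_transpose_apply (U V : Matrix (Fin n) (Fin n) ℝ) (i k x y : Fin n) :
    (U * (single i k (1 : ℝ) : Matrix (Fin n) (Fin n) ℝ) * Vᵀ) x y = U x i * V y k := by
  simp [mul_apply, single_apply, ite_and]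

theorem exists_rotation_of_orthogonal {ν : ℝ} (hν : 0 < ν) {y z : Fin m → ℝ}
    (hy : ∑ s, y s ^ 2 = ν) (hz : ∑ s, z s ^ 2 = ν) (hyz : ∑ s, y s * z s = 0) :
    2 ≤ m ∧ ∃ R ∈ Matrix.orthogonalGroup (Fin m) ℝ,
      (∀ r, ∑ s, R s r * y s = if r.val = 0 then √ν else 0) ∧
      ∀ r, ∑ s, R s r * z s = if r.val = 1 then -√ν else 0 := by
  have hm : 2 ≤ m := by
    by_contra! h
    interval_cases m
    · simp at hy; linarith
    · simp only [Finset.univ_unique, Finset.sum_singleton] at hy hz hyz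
      rcases mul_eq_zero.1 hyz with h0 | h0
      · rw [h0] at hy; norm_num at hy; linarith
      · rw [h0] at hz; norm_num at hz; linarith
  refine ⟨hm, ?_⟩
  have hs : √ν * √ν = ν := Real.mul_self_sqrt hν.le
  have hs0 : √ν ≠ 0 := (Real.sqrt_pos.2 hν).ne'
  have hyy : y ⬝ᵥ y = ν := by rw [← hy]; simp [dotProduct, sq]
  have hzz : z ⬝ᵥ z = ν := by rw [← hz]; simp [dotProduct, sq]
  have hyz' : y ⬝ᵥ z = 0 := hyz
  have hzy : z ⬝ᵥ y = 0 := by rw [dotProduct_comm]; exact hyz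
  have hinv : (√ν)⁻¹ * ((√ν)⁻¹ * ν) = 1 := by
    nth_rewrite 3 [← hs]; field_simp
  -- The first two columns of R are y/√ν and -z/√ν; the minus sign matches the sign of `matC2` in
  -- the final normal form. Columns from index 2 on are unconstrained.
  obtain ⟨R, hR, hcol⟩ := exists_orthogonal_extension
    (fun r : Fin m => if r.val = 0 then (√ν)⁻¹ • y else -((√ν)⁻¹ • z)) {r | r.val < 2}
    (fun i hi j hj => by
      have hi' : i.val < 2 := hi
      have hj' : j.val < 2 := hj
      by_cases h0 : i.val = 0 <;> by_cases h1 : j.val = 0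
      · rw [if_pos h0, if_pos h1, if_pos (Fin.ext (by omega))]
        simp [hyy, hinv]
      · rw [if_pos h0, if_neg h1, if_neg (fun h => by rw [h] at h0; omega)]
        simp [hyz']
      · rw [if_neg h0, if_pos h1, if_neg (fun h => by rw [h] at h0; omega)]
        simp [hzy]
      · rw [if_neg h0, if_neg h1, if_pos (Fin.ext (by omega))]
        simp [hzz, hinv])
  refine ⟨R, hR, ?_⟩
  have hRR := mem_orthogonalGroup_iff_transpose_mul.1 hR
  have hy' : ∀ s, y s = √ν * R s ⟨0, by omega⟩ := fun s => by
    rw [hcol ⟨0, by omega⟩ (by simp) s]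
    simp [hs0]
  have hz' : ∀ s, z s = -√ν * R s ⟨1, by omega⟩ := fun s => by
    rw [hcol ⟨1, by omega⟩ (by simp) s]
    simp [hs0]
  have hRe : ∀ r r', ∑ s, R s r * R s r' = if r = r' then 1 else 0 := fun r r' => by
    have := congrFun (congrFun hRR r) r'
    simpa [mul_apply, one_apply] using this
  constructor <;> intro r
  · simp only [hy', mul_left_comm _ (√ν), ← Finset.mul_sum, hRe, Fin.ext_iff]
    simp
  · simp only [hz', mul_left_comm _ (-√ν), ← Finset.mul_sum, hRe, Fin.ext_iff]
    simp

/-- Tuples in `Q(p, q)` attaining equality are equivalent to a multiple of the model tuple. -/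
theorem exists_kAct_eq_modelTuple {a : Fin m → Matrix (Fin n) (Fin n) ℝ}
    (hmul : ∀ r s, a r * a s = 0)
    (ha : ∑ r, ∑ s, blockCommSq (a r) (a s) = 2 * (∑ s, frobInner (a s) (a s)) ^ 2) :
    ∃ P ∈ Matrix.orthogonalGroup (Fin n) ℝ, ∃ R ∈ Matrix.orthogonalGroup (Fin m) ℝ,
      ∃ c : ℝ, 0 ≤ c ∧ (c ≠ 0 → 4 ≤ n ∧ 2 ≤ m) ∧
        kAct P R (fun r => a r + (a r)ᵀ) = c • modelTuple n m := by
  rcases (Finset.sum_nonneg fun s _ => frobInner_self_nonneg (a s)).eq_or_lt with h0 | hpos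
  · have hz : ∀ s, a s = 0 := fun s => by
      have := (Finset.sum_eq_zero_iff_of_nonneg fun s _ => frobInner_self_nonneg (a s)).1 h0.symm s
        (Finset.mem_univ s)
      rwa [frobInner_eq_trace, ← conjTranspose_eq_transpose_of_trivial,
        trace_mul_conjTranspose_self_eq_zero_iff] at this
    refine ⟨1, one_mem _, 1, one_mem _, 0, le_rfl, fun h => absurd rfl h, ?_⟩
    ext r
    simp [kAct, hz]
  obtain ⟨U, hU, V, hV, i, k, hik, ν, y, z, hν, hy, hz, hyz, hform⟩ := exists_plane_form hpos ha
  obtain ⟨hm, R, hR, hRy, hRz⟩ := exists_rotation_of_orthogonal hν hy hz hyz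
  have hUU := mem_orthogonalGroup_iff_transpose_mul.1 hU
  have hVV := mem_orthogonalGroup_iff_transpose_mul.1 hV
  set S : Matrix (Fin n) (Fin n) ℝ := single i i 1 + single k k 1 with hS
  set J : Matrix (Fin n) (Fin n) ℝ := single i k 1 - single k i 1 with hJ
  have hsplit : ∀ s, a s = y s • (U * S * Vᵀ) + z s • (U * J * Vᵀ) := fun s => by
    rw [hform s, Matrix.mul_add, Matrix.add_mul, Matrix.mul_smul, Matrix.mul_smul,
      Matrix.smul_mul, Matrix.smul_mul]
  -- Since y ⟂ z, weighting by y isolates U S Vᵀ, which thereby inherits square zero from the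
  -- products `a r * a s`.
  have hSsum : ∑ s, y s • a s = ν • (U * S * Vᵀ) := by
    simp only [hsplit, smul_add, smul_smul, Finset.sum_add_distrib, ← Finset.sum_smul, hyz,
      zero_smul, add_zero, ← sq, hy]
  have hSS : (U * S * Vᵀ) * (U * S * Vᵀ) = 0 := by
    have h : (∑ s, y s • a s) * (∑ s, y s • a s) = 0 := by
      simp [Finset.sum_mul, Finset.mul_sum, hmul]
    rw [hSsum, Matrix.smul_mul, Matrix.mul_smul, smul_smul] at h
    exact (smul_eq_zero.1 h).resolve_left (mul_pos hν hν).ne'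
  have hSVUS : S * (Vᵀ * U) * S = 0 := by
    have h := congrArg (fun x => Uᵀ * (x * V)) hSS
    simp only [Matrix.mul_assoc, hVV, Matrix.mul_one, Matrix.zero_mul, Matrix.mul_zero] at h
    rw [← Matrix.mul_assoc Uᵀ U, hUU, Matrix.one_mul] at h
    simpa only [Matrix.mul_assoc] using h
  have hSd : S = diagonal fun j => if j = i ∨ j = k then 1 else 0 := by
    ext j l
    simp only [hS, Matrix.add_apply, single_apply, diagonal_apply]
    by_cases hjl : j = l
    · subst hjl
      by_cases h1 : j = i
      · subst h1; simp [hik.symm]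
      · by_cases h2 : j = k
        · subst h2; simp [hik]
        · simp [h1, h2, Ne.symm h1, Ne.symm h2]
    · have h1 : ¬ (i = j ∧ i = l) := fun h => hjl (h.1.symm.trans h.2)
      have h2 : ¬ (k = j ∧ k = l) := fun h => hjl (h.1.symm.trans h.2)
      simp [hjl, h1, h2]
  have hVU : ∀ j l, (j = i ∨ j = k) → (l = i ∨ l = k) → ∑ x, V x j * U x l = 0 :=
    fun j l hj hl => by
      have h := congrFun (congrFun hSVUS j) l
      rw [hSd, mul_diagonal, diagonal_mul, if_pos hj, if_pos hl, one_mul, mul_one] at h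
      simpa [mul_apply] using h
  have hUV : ∀ j l, (j = i ∨ j = k) → (l = i ∨ l = k) → ∑ x, U x j * V x l = 0 :=
    fun j l hj hl => by
      rw [← hVU l j hl hj]; exact Finset.sum_congr rfl fun _ _ => mul_comm _ _
  have hUe : ∀ j l, ∑ x, U x j * U x l = if j = l then 1 else 0 := fun j l => by
    have := congrFun (congrFun hUU j) l
    simpa [mul_apply, one_apply] using this
  have hVe : ∀ j l, ∑ x, V x j * V x l = if j = l then 1 else 0 := fun j l => by
    have := congrFun (congrFun hVV j) l
    simpa [mul_apply, one_apply] using this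
  -- S (Vᵀ U) S = 0 says that columns i, k of U are orthogonal to columns i, k of V. These four
  -- vectors are thus orthonormal, which also forces n ≥ 4.
  set W : Matrix (Fin n) (Fin 4) ℝ := of fun x => ![U x i, U x k, V x i, V x k] with hW
  have hWW : Wᵀ * W = 1 := by
    ext α β
    fin_cases α <;> fin_cases β <;>
      simp [hW, mul_apply, hUe, hVe, hUV, hVU, hik, hik.symm]
  obtain ⟨P, hP, hPW⟩ := exists_orthogonal_mul_firstFour hWW
  have hC1 : U * S * Vᵀ + (U * S * Vᵀ)ᵀ = W * matC1 * Wᵀ := by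
    ext x y
    rw [hS, Matrix.mul_add, Matrix.add_mul]
    simp only [Matrix.add_apply, transpose_apply, mul_single_mul_transpose_apply]
    simp [hW, matC1, mul_apply, Fin.sum_univ_four]
    ring
  have hC2 : U * J * Vᵀ + (U * J * Vᵀ)ᵀ = -(W * matC2 * Wᵀ) := by
    ext x y
    rw [hJ, Matrix.mul_sub, Matrix.sub_mul]
    simp only [Matrix.add_apply, Matrix.sub_apply, Matrix.neg_apply, transpose_apply,
      mul_single_mul_transpose_apply]
    simp [hW, matC2, mul_apply, Fin.sum_univ_four]
    ring
  have hB : ∀ s, Pᵀ * (a s + (a s)ᵀ) * P =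
      y s • diagZero n matC1 - z s • diagZero n matC2 := fun s => by
    have : a s + (a s)ᵀ = y s • (W * matC1 * Wᵀ) - z s • (W * matC2 * Wᵀ) := by
      rw [hsplit s, transpose_add, transpose_smul, transpose_smul, add_add_add_comm, ← smul_add,
        ← smul_add, hC1, hC2, smul_neg, sub_eq_add_neg]
    rw [this, ← transpose_mul_conj_mul_eq_diagZero hP, ← transpose_mul_conj_mul_eq_diagZero hP,
      hPW, Matrix.mul_sub, Matrix.sub_mul, Matrix.mul_smul, Matrix.mul_smul, Matrix.smul_mul,
      Matrix.smul_mul]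
  refine ⟨P, hP, R, hR, √ν, Real.sqrt_nonneg _,
    fun _ => ⟨four_le_of_orthonormal_columns hWW, hm⟩, funext fun r => ?_⟩
  simp only [kAct, hB, smul_sub, smul_smul, Finset.sum_sub_distrib, ← Finset.sum_smul, hRy, hRz,
    Pi.smul_apply, modelTuple]
  by_cases h0 : r.val = 0
  · simp [h0]
  · by_cases h1 : r.val = 1 <;> simp [h0, h1]

end NormalForm

theorem theorem1p1 (p q m : ℕ) (B : Fin m → Matrix (Fin (p + q)) (Fin (p + q)) ℝ)
    (hB : ∀ r, B r ∈ austereQ p q) :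
    (∑ r, ∑ s, frobSq (matComm (B r) (B s)) ≤ (1 / 2 : ℝ) * (∑ r, frobSq (B r)) ^ 2) ∧
    (∑ r, ∑ s, frobSq (matComm (B r) (B s)) = (1 / 2 : ℝ) * (∑ r, frobSq (B r)) ^ 2 ↔
      ∃ P ∈ Matrix.orthogonalGroup (Fin (p + q)) ℝ,
      ∃ R ∈ Matrix.orthogonalGroup (Fin m) ℝ,
      ∃ c : ℝ, 0 ≤ c ∧ (c ≠ 0 → 4 ≤ p + q ∧ 2 ≤ m) ∧
        kAct P R B = c • modelTuple (p + q) m) := by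
  obtain ⟨a, ha, hmul⟩ := exists_corner hB
  obtain rfl : B = fun r => a r + (a r)ᵀ := funext ha
  have hL : ∀ r s, frobSq (matComm (a r + (a r)ᵀ) (a s + (a s)ᵀ)) = blockCommSq (a r) (a s) :=
    fun r s => frobSq_matComm_add_transpose (hmul r r) (hmul r s) (hmul s r) (hmul s s)
  have hR : (1 / 2 : ℝ) * (∑ r, frobSq (a r + (a r)ᵀ)) ^ 2 =
      2 * (∑ s, frobInner (a s) (a s)) ^ 2 := by
    simp only [frobSq_add_transpose (hmul _ _), ← Finset.mul_sum]; ring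
  refine ⟨?_, fun h => ?_, ?_⟩
  · simp only [hL, hR]
    exact sum_blockCommSq_le a
  · simp only [hL, hR] at h
    exact exists_kAct_eq_modelTuple hmul h
  · rintro ⟨P, hP, R, hR, c, -, hc, h⟩
    exact equality_of_kAct_eq_modelTuple hP hR hc h
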